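/- Let $Q=ABCD$ be a simple spherical quadrilateral on the unit sphere whose edges are geodesic arcs with lengths $|AB|=|AD|=a$, $|BC|=b$, $|CD|=c$, where $a,b,c$ are distinct, and let $\alpha,\beta,\gamma,\delta\in(0,2\pi)$ be its interior angles at $A,B,C,D$. Consider an edge-to-edge tiling of the sphere by $f$ tiles congruent to $Q$ (mirror images allowed) in which every vertex has degree at least $3$. Say that $\alpha^{p}\beta^{q}\gamma^{r}\delta^{s}$ is a vertex of the tiling if at some vertex of the tiling exactly $p$ tiles have their corner $A$, $q$ their corner $B$, $r$ their corner $C$ and $s$ their corner $D$. If $\beta\gamma\delta$ is a vertex, then $f$ is even, $\alpha=4\pi/f$, the set of all vertices of the tiling is exactly $\{\beta\gamma\delta,\ \alpha^{f/2}\}$, and the tiling is an earth map tiling. Conversely, $\beta\gamma\delta$ is a vertex of every earth map tiling. Here the tiling is an earth map tiling if, for some $n\ge 3$, its tiles can be labelled $T_i,S_i$ ($i\in\mathbb{Z}/n$) so that the vertices $A,B,C,D$ are $N,P_i,R_i,P_{i-1}$ for $T_i$ and $S,R_i,P_i,R_{i+1}$ for $S_i$, where $N,S,P_i,R_i$ ($i\in\mathbb{Z}/n$)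 are $2n+2$ distinct points, and so that two edges of tiles coincide exactly when their end points carry the same unordered pair of these names. -/

import Mathlib

open Real Set Filter Topology

/-- Euclidean three-space. -/
abbrev E3 : Type := EuclideanSpace ℝ (Fin 3)

/-- The unit sphere in Euclidean three-space, with the subspace topology. -/
abbrev S2 : Type := Metric.sphere (0 : E3) 1

/-- The cross product on Euclidean three-space. -/
def cross (x y : E3) : E3 :=
  WithLp.toLp 2 (crossProduct (WithLp.ofLp x) (WithLp.ofLp y))

/-- The point at arc length `t` on the unit speed great circle that starts at the unit vector `p`
in the direction of the unit tangent vector `u`. -/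
noncomputable def greatArc (p u : E3) (t : ℝ) : E3 :=
  Real.cos t • p + Real.sin t • u

/-- The action of a linear isometry of three-space on the unit sphere. -/
noncomputable def sphereMap (g : E3 ≃ₗᵢ[ℝ] E3) (x : S2) : S2 :=
  ⟨g x, by
    have hx : ‖(x : E3)‖ = 1 := norm_eq_of_mem_sphere x
    simp [hx]⟩

/-- A simple closed path on the sphere made of four geodesic arcs (arcs of great circles, of any
positive length). The vertices `0, 1, 2, 3` are `A, B, C, D`; the edge `k` joins the vertex `k` to
the vertex `k + 1` (cyclically), so the edges `0, 1, 2, 3` are `AB, BC, CD, DA`. -/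
structure GeodesicFourPath where
  /-- the vertices -/
  vertex : Fin 4 → S2
  /-- the unit tangent vector at the vertex `k` that points along the edge `k` -/
  dir : Fin 4 → E3
  /-- the lengths of the edges -/
  len : Fin 4 → ℝ
  norm_dir : ∀ k, ‖dir k‖ = 1
  dir_tangent : ∀ k, inner ℝ (vertex k : E3) (dir k) = 0
  len_pos : ∀ k, 0 < len k
  closed : ∀ k, greatArc (vertex k) (dir k) (len k) = (vertex (k + 1) : E3)
  simple : ∀ (k l : Fin 4) (s t : ℝ), s ∈ Ico 0 (len k) → t ∈ Ico 0 (len l) →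
    greatArc (vertex k) (dir k) s = greatArc (vertex l) (dir l) t → k = l ∧ s = t

namespace GeodesicFourPath

/-- The edge `k` with its two end points, as a set of points of the sphere. -/
def edge (P : GeodesicFourPath) (k : Fin 4) : Set S2 :=
  {x | ∃ t ∈ Icc 0 (P.len k), (x : E3) = greatArc (P.vertex k) (P.dir k) t}

/-- The unit normal of the edge `k` that points to the left of a traveller who walks along the edge
on the outside of the sphere. It is the same vector at all points of the edge. -/
def leftNormal (P : GeodesicFourPath) (k : Fin 4) : E3 :=
  cross (P.vertex k) (P.dir k)

/-- The unit tangent vector at the vertex `k + 1` that points back along the edge `k`. -/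
noncomputable def backDir (P : GeodesicFourPath) (k : Fin 4) : E3 :=
  Real.sin (P.len k) • (P.vertex k : E3) - Real.cos (P.len k) • P.dir k

end GeodesicFourPath

/-- A simple spherical quadrilateral `ABCD`: a closed region of the sphere, equal to the closure of
its connected interior, whose boundary is a simple closed path of four geodesic arcs, labelled so
that the region lies on the left of the path. -/
structure SphericalQuadrilateral extends GeodesicFourPath where
  /-- the closed region -/
  region : Set S2
  closure_interior_region : closure (interior region) = region
  isConnected_interior_region : IsConnected (interior region)
  frontier_region : frontier region = ⋃ k, toGeodesicFourPath.edge k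
  region_left : ∀ (k : Fin 4), ∀ t ∈ Ioo 0 (len k), ∀ᶠ ε in 𝓝[>] (0 : ℝ),
    greatArc (greatArc (vertex k) (dir k) t) (toGeodesicFourPath.leftNormal k) ε ∈
      ((↑) '' region : Set E3)
  /-- the interior angles: `angle k` is the counterclockwise angle, strictly between `0` and `2π`,
  from the edge that leaves the vertex `k` to the edge that arrives there -/
  angle : Fin 4 → ℝ
  angle_pos : ∀ k, 0 < angle k
  angle_lt : ∀ k, angle k < 2 * π
  angle_spec : ∀ k, toGeodesicFourPath.backDir k =
    Real.cos (angle (k + 1)) • dir (k + 1) +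
      Real.sin (angle (k + 1)) • toGeodesicFourPath.leftNormal (k + 1)

/-- Edge combination `a²bc` in the default arrangement: `AB` and `DA` have the same length `a`,
`BC` has length `b`, `CD` has length `c`, and `a`, `b`, `c` are distinct. Then the angles
`α, β, γ, δ` are `angle 0, angle 1, angle 2, angle 3`. -/
def SphericalQuadrilateral.IsA2BC (Q : SphericalQuadrilateral) : Prop :=
  Q.len 0 = Q.len 3 ∧ Q.len 0 ≠ Q.len 1 ∧ Q.len 0 ≠ Q.len 2 ∧ Q.len 1 ≠ Q.len 2

/-- The copy under `g` of the vertex `k` of `Q`. -/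
noncomputable def SphericalQuadrilateral.cornerAt (Q : SphericalQuadrilateral) (g : E3 ≃ₗᵢ[ℝ] E3) (k : Fin 4) :
    S2 :=
  sphereMap g (Q.vertex k)

/-- The copy under `g` of the edge `k` of `Q`. -/
def SphericalQuadrilateral.edgeAt (Q : SphericalQuadrilateral) (g : E3 ≃ₗᵢ[ℝ] E3) (k : Fin 4) :
    Set S2 :=
  sphereMap g '' Q.edge k

/-- The copy under `g` of the region of `Q`. -/
def SphericalQuadrilateral.tileAt (Q : SphericalQuadrilateral) (g : E3 ≃ₗᵢ[ℝ] E3) : Set S2 :=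
  sphereMap g '' Q.region

/-- An edge-to-edge tiling of the sphere by `f` tiles congruent to `Q` (mirror images are allowed)
in which all vertices have degree at least `3`. -/
structure SphereTiling (Q : SphericalQuadrilateral) (f : ℕ) where
  /-- the isometry that carries `Q` to the tile `i` -/
  place : Fin f → (E3 ≃ₗᵢ[ℝ] E3)
  cover : ⋃ i, Q.tileAt (place i) = univ
  nonoverlapping : ∀ i j, i ≠ j →
    Disjoint (interior (Q.tileAt (place i))) (interior (Q.tileAt (place j)))
  /-- two edges of tiles coincide, or meet at most in common end points -/
  edge_to_edge : ∀ (i j : Fin f) (k l : Fin 4),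
    Q.edgeAt (place i) k = Q.edgeAt (place j) l ∨
      Q.edgeAt (place i) k ∩ Q.edgeAt (place j) l ⊆
        {Q.cornerAt (place i) k, Q.cornerAt (place i) (k + 1)} ∩
          {Q.cornerAt (place j) l, Q.cornerAt (place j) (l + 1)}
  degree_ge : ∀ (i : Fin f) (k : Fin 4),
    3 ≤ ∑ l : Fin 4, Nat.card {j : Fin f // Q.cornerAt (place j) l = Q.cornerAt (place i) k}

namespace SphereTiling

variable {Q : SphericalQuadrilateral} {f : ℕ}

/-- The vertex `k` of the tile `i`. -/
noncomputable def corner (T : SphereTiling Q f) (i : Fin f) (k : Fin 4) : S2 :=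
  Q.cornerAt (T.place i) k

/-- The edge `k` of the tile `i`. -/
def edge (T : SphereTiling Q f) (i : Fin f) (k : Fin 4) : Set S2 :=
  Q.edgeAt (T.place i) k

/-- The numbers of angles `α, β, γ, δ` at the point `p`: the vertex `α^a β^b γ^c δ^d` has type
`![a, b, c, d]`. -/
noncomputable def vertexType (T : SphereTiling Q f) (p : S2) : Fin 4 → ℕ :=
  fun k => Nat.card {i : Fin f // T.corner i k = p}

/-- The anglewise vertex combination: the set of the types of all vertices of the tiling. -/
def AVC (T : SphereTiling Q f) : Set (Fin 4 → ℕ) :=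
  {v | ∃ (i : Fin f) (k : Fin 4), v = T.vertexType (T.corner i k)}

end SphereTiling

/-- The vertices of the earth map with `n` time zones: two poles and two rings of `n` vertices. -/
inductive EarthVertex (n : ℕ) : Type
  | north : EarthVertex n
  | south : EarthVertex n
  | upper : ZMod n → EarthVertex n
  | lower : ZMod n → EarthVertex n

/-- The vertices `A, B, C, D` of the tiles of the earth map. The time zone `i` consists of the tile
`(i, true)` at the north pole and the tile `(i, false)` at the south pole, which share their edge
`BC`, in opposite directions. -/
def earthCorner (n : ℕ) : ZMod n × Bool → Fin 4 → EarthVertex n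
  | (i, true) => ![.north, .upper i, .lower i, .upper (i - 1)]
  | (i, false) => ![.south, .lower i, .upper i, .lower (i + 1)]

/-- The edge `k` of a tile of the earth map, as the unordered pair of its end points. -/
def earthEdge (n : ℕ) (z : ZMod n × Bool) (k : Fin 4) : Sym2 (EarthVertex n) :=
  s(earthCorner n z k, earthCorner n z (k + 1))

/-- The tiling is an earth map tiling: for some `n ≥ 3` its tiles can be identified with those of
the earth map with `n` time zones so that the vertices `A, B, C, D` of the tiles, and their edges,
coincide exactly when they do so in the earth map. -/
def SphereTiling.IsEarthMap {Q : SphericalQuadrilateral} {f : ℕ} (T : SphereTiling Q f) : Prop :=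
  ∃ n : ℕ, 3 ≤ n ∧ ∃ e : Fin f ≃ ZMod n × Bool,
    (∀ i j k l, T.corner i k = T.corner j l ↔ earthCorner n (e i) k = earthCorner n (e j) l) ∧
    (∀ i j k l, T.edge i k = T.edge j l ↔ earthEdge n (e i) k = earthEdge n (e j) l)

/-! The tiles at a vertex fill the directions there exactly once, so their angles sum to 2π
(`sum_angle_eq`); hence β + γ + δ = 2π. Since a, b, c are distinct, BC is glued only to BC and CD
only to CD. The edges b ending at a point are therefore shared in pairs, so the corners B and C
there are even in total number, and likewise the corners C and D (`even_vertexType_add`).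

Angle sum and parity force every corner B, C, D to lie at a vertex βγδ (`vertexType_eq_of_mem_AVC`).
If β or δ is at least π, it occurs once at each of its vertices, since two copies would leave degree
2; parity then supplies the other two angles, and counting corners settles the rest. If both are
less than π, a vertex with β and γ but no δ would by parity contain β²γ², whereas 2β + 2γ = 4π − 2δ
> 2π; similarly for γ and δ. So βγδ spreads from tile to tile across shared edges, and the tiling is
connected through edges (`forall_mem_of_edge_closed`).

Now corners A meet only corners A, and all gluings are determined. With φ the neighbour across AB
and ψ the neighbour across BC, φψφ = ψ, so an orbit of φ and its image under ψ are closed under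
adjacency and exhaust the tiles (`exists_rings`). Their poles differ, because tiles all having A at
one point would share an edge three at a time (`exists_corner_zero_ne`). Hence f = 2n and α = 2π/n,
and the incidences are those of the earth map. For the converse it suffices to count the corners at
one point of the earth map. -/

section arcs

/-! ### Great circle arcs and their lengths. -/

variable {p u : E3}

theorem map_greatArc (g : E3 ≃ₗᵢ[ℝ] E3) (p u : E3) (t : ℝ) :
    g (greatArc p u t) = greatArc (g p) (g u) t := by
  simp [greatArc]

theorem continuous_greatArc (p u : E3) : Continuous (greatArc p u) := by
  unfold greatArc; fun_prop

@[simp] theorem greatArc_zero (p u : E3) : greatArc p u 0 = p := by simp [greatArc]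

theorem inner_greatArc_left (hp : ‖p‖ = 1) (hpu : inner ℝ p u = 0) (t : ℝ) :
    inner ℝ p (greatArc p u t) = cos t := by
  simp [greatArc, inner_add_right, inner_smul_right, hpu, hp]

theorem inner_greatArc_right (hu : ‖u‖ = 1) (hpu : inner ℝ p u = 0) (t : ℝ) :
    inner ℝ u (greatArc p u t) = sin t := by
  rw [real_inner_comm] at hpu
  simp [greatArc, inner_add_right, inner_smul_right, hpu, hu]

theorem norm_greatArc (hp : ‖p‖ = 1) (hu : ‖u‖ = 1) (hpu : inner ℝ p u = 0) (t : ℝ) :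
    ‖greatArc p u t‖ = 1 := by
  have h : ‖greatArc p u t‖ ^ 2 = 1 := by
    rw [greatArc, norm_add_sq_real, inner_smul_left, inner_smul_right, hpu]
    simp [norm_smul, hp, hu]
  nlinarith [norm_nonneg (greatArc p u t)]

theorem eq_of_cos_eq_of_sin_eq {s t : ℝ} (hs : s ∈ Ico 0 (2 * π)) (ht : t ∈ Ico 0 (2 * π))
    (hc : cos s = cos t) (hsin : sin s = sin t) : s = t := by
  have h := Real.Angle.cos_sin_inj hc hsin
  obtain ⟨m, hm⟩ := Real.Angle.angle_eq_iff_two_pi_dvd_sub.mp h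
  have h1 : (m : ℝ) < 1 := by
    by_contra! hc
    nlinarith [hs.1, hs.2, ht.1, ht.2, pi_pos]
  have h2 : (-1 : ℝ) < m := by
    by_contra! hc
    nlinarith [hs.1, hs.2, ht.1, ht.2, pi_pos]
  have h3 : m = 0 := by
    have h1 : m < 1 := by exact_mod_cast h1
    have h2 : -1 < m := by exact_mod_cast h2
    omega
  rw [h3] at hm
  simp at hm
  linarith

theorem greatArc_injOn (hp : ‖p‖ = 1) (hu : ‖u‖ = 1) (hpu : inner ℝ p u = 0) :
    InjOn (greatArc p u) (Ico 0 (2 * π)) := by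
  intro s hs t ht h
  apply eq_of_cos_eq_of_sin_eq hs ht
  · rw [← inner_greatArc_left hp hpu, h, inner_greatArc_left hp hpu]
  · rw [← inner_greatArc_right hu hpu, h, inner_greatArc_right hu hpu]

/-- The great circle arc of length `L` from `p` in the direction `u`. -/
def arc (p u : E3) (L : ℝ) : Set S2 := {x | ∃ t ∈ Icc 0 L, (x : E3) = greatArc p u t}

theorem isClosed_arc (p u : E3) (L : ℝ) : IsClosed (arc p u L) := by
  have h : arc p u L = (↑) ⁻¹' (greatArc p u '' Icc 0 L) := by
    ext x
    constructor
    · rintro ⟨t, ht, h⟩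
      exact ⟨t, ht, h.symm⟩
    · rintro ⟨t, ht, h⟩
      exact ⟨t, ht, h.symm⟩
  rw [h]
  exact ((isCompact_Icc.image (continuous_greatArc p u)).isClosed).preimage continuous_subtype_val

/-- The vector `sin L • p - cos L • u` is the tangent at the end of the arc that points back along
it. -/
theorem greatArc_reverse (p u : E3) (L t : ℝ) :
    greatArc (greatArc p u L) (sin L • p - cos L • u) t = greatArc p u (L - t) := by
  simp only [greatArc, cos_sub, sin_sub]
  module

theorem arc_reverse (p u : E3) (L : ℝ) :
    arc (greatArc p u L) (sin L • p - cos L • u) L = arc p u L := by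
  ext x
  constructor
  · rintro ⟨t, ht, h⟩
    exact ⟨L - t, ⟨by linarith [ht.2], by linarith [ht.1]⟩, by rw [h, greatArc_reverse]⟩
  · rintro ⟨t, ht, h⟩
    exact ⟨L - t, ⟨by linarith [ht.2], by linarith [ht.1]⟩, by
      rw [h, greatArc_reverse, sub_sub_cancel]⟩

theorem norm_reverse (hp : ‖p‖ = 1) (hu : ‖u‖ = 1) (hpu : inner ℝ p u = 0) (L : ℝ) :
    ‖sin L • p - cos L • u‖ = 1 := by
  have h : ‖sin L • p - cos L • u‖ ^ 2 = 1 := by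
    rw [norm_sub_sq_real, inner_smul_left, inner_smul_right, hpu]
    simp [norm_smul, hp, hu]
  nlinarith [norm_nonneg (sin L • p - cos L • u)]

theorem inner_reverse (hp : ‖p‖ = 1) (hu : ‖u‖ = 1) (hpu : inner ℝ p u = 0) (L : ℝ) :
    inner ℝ (greatArc p u L) (sin L • p - cos L • u) = 0 := by
  have hup : inner ℝ u p = 0 := by rw [real_inner_comm, hpu]
  simp [greatArc, inner_add_left, inner_sub_right, inner_smul_left, inner_smul_right, hpu, hup,
    hp, hu]
  ring

/-- Two arcs with the same starting point that coincide as sets have the same length. -/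
theorem arc_length_eq_of_start_eq {u' : E3} {L L' : ℝ} (hp : ‖p‖ = 1) (hu : ‖u‖ = 1)
    (hpu : inner ℝ p u = 0) (hu' : ‖u'‖ = 1) (hpu' : inner ℝ p u' = 0) (hL : L ∈ Ioo 0 (2 * π))
    (hL' : L' ∈ Ioo 0 (2 * π)) (h : arc p u L = arc p u' L') : L = L' := by
  have key : ∀ {u u' : E3} {L L' : ℝ}, ‖u‖ = 1 → inner ℝ p u = 0 → ‖u'‖ = 1 →
      inner ℝ p u' = 0 → L ∈ Ioo 0 (2 * π) → L' ∈ Ioo 0 (2 * π) → arc p u L = arc p u' L' →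
      ∀ t ∈ Icc 0 L', ∃ s ∈ Icc 0 L, greatArc p u' t = greatArc p u s := by
    intro u u' L L' hu hpu hu' hpu' hL hL' h t ht
    have hx : (⟨greatArc p u' t, by simp [norm_greatArc hp hu' hpu']⟩ : S2) ∈ arc p u L := by
      rw [h]
      exact ⟨t, ht, rfl⟩
    obtain ⟨s, hs, hs'⟩ := hx
    exact ⟨s, hs, hs'⟩
  -- The cosine is the inner product with `p`, so a point of one arc at parameter t < π has on the
  -- other arc a parameter with the same cosine, hence with the same sine up to sign.
  have hcase : u' = u ∨ u' = -u := by
    set t := min (L' / 2) (π / 2) with ht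
    have ht0 : 0 < t := lt_min (by linarith [hL'.1]) (by positivity)
    have htπ : t < π := (min_le_right _ _).trans_lt (by linarith [pi_pos])
    obtain ⟨s, -, hs⟩ := key hu hpu hu' hpu' hL hL' h t
      ⟨ht0.le, (min_le_left _ _).trans (by linarith [hL'.1])⟩
    have hc : cos t = cos s := by
      rw [← inner_greatArc_left hp hpu', hs, inner_greatArc_left hp hpu]
    have hst : sin t ≠ 0 := (sin_pos_of_pos_of_lt_pi ht0 htπ).ne'
    have h2 : sin t • u' = sin s • u := by
      simpa [greatArc, hc] using hs
    have h3 : sin s = sin t ∨ sin s = -sin t := by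
      apply sq_eq_sq_iff_eq_or_eq_neg.mp
      rw [sin_sq, sin_sq, hc]
    rcases h3 with h3 | h3
    · left
      rw [h3] at h2
      exact smul_right_injective _ hst h2
    · right
      rw [h3, neg_smul, ← smul_neg] at h2
      exact smul_right_injective _ hst h2
  have hle : ∀ {L L' : ℝ}, L ∈ Ioo 0 (2 * π) → L' ∈ Ioo 0 (2 * π) → arc p u L = arc p u L' →
      L' ≤ L := by
    intro L L' hL hL' h
    obtain ⟨s, hs, hs'⟩ := key hu hpu hu hpu hL hL' h L' ⟨hL'.1.le, le_rfl⟩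
    have := greatArc_injOn hp hu hpu ⟨hL'.1.le, hL'.2⟩ ⟨hs.1, hs.2.trans_lt hL.2⟩ hs'
    rw [this]
    exact hs.2
  rcases hcase with rfl | rfl
  · exact le_antisymm (hle hL' hL h.symm) (hle hL hL' h)
  -- Leaving in the opposite direction means having parameters just below 2π, which `L < 2 * π`
  -- excludes. The witness below is at most half the gap 2π − L.
  · exfalso
    have hneg : ∀ t, greatArc p (-u) t = greatArc p u (2 * π - t) := by
      intro t
      simp [greatArc, cos_two_pi_sub, sin_two_pi_sub]
    have hin : ∀ t ∈ Ioc 0 L', 2 * π - t ≤ L := by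
      intro t ht
      obtain ⟨s, hs, hs'⟩ := key hu hpu hu' hpu' hL hL' h t ⟨ht.1.le, ht.2⟩
      rw [hneg] at hs'
      have := greatArc_injOn hp hu hpu ⟨by linarith [ht.2, hL'.2], by linarith [ht.1]⟩
        ⟨hs.1, hs.2.trans_lt hL.2⟩ hs'
      rw [this]
      exact hs.2
    have h1 := hin (min L' ((2 * π - L) / 2)) ⟨lt_min hL'.1 (by linarith [hL.2]), min_le_left _ _⟩
    have h2 := min_le_right L' ((2 * π - L) / 2)
    linarith [hL.2]

end arcs

/-! ### Polar coordinates around a point of the sphere. -/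

section polar

/-- The point with polar coordinates `(ε, s)` in the frame `F`: at distance `ε` from `F 0`, in the
direction `s` measured from `F 1` to `F 2`. -/
noncomputable def polarPoint (F : OrthonormalBasis (Fin 3) ℝ E3) (s ε : ℝ) : S2 :=
  ⟨greatArc (F 0) (cos s • F 1 + sin s • F 2) ε, by
    have h : ‖cos s • F 1 + sin s • F 2‖ = 1 := by
      have h : ‖cos s • F 1 + sin s • F 2‖ ^ 2 = 1 := by
        rw [norm_add_sq_real, inner_smul_left, inner_smul_right,
          F.orthonormal.inner_eq_zero (by decide)]
        simp [norm_smul]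
      nlinarith [norm_nonneg (cos s • F 1 + sin s • F 2)]
    rw [mem_sphere_zero_iff_norm]
    apply norm_greatArc (by simp) h
    rw [inner_add_right, inner_smul_right, inner_smul_right,
      F.orthonormal.inner_eq_zero (by decide), F.orthonormal.inner_eq_zero (by decide)]
    simp⟩

variable (F : OrthonormalBasis (Fin 3) ℝ E3)

theorem coe_polarPoint (s ε : ℝ) :
    (polarPoint F s ε : E3) = cos ε • F 0 + (sin ε * cos s) • F 1 + (sin ε * sin s) • F 2 := by
  simp only [polarPoint, greatArc]
  module

theorem inner_combination (a b c : ℝ) :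
    inner ℝ (F 0) (a • F 0 + b • F 1 + c • F 2) = a ∧
      inner ℝ (F 1) (a • F 0 + b • F 1 + c • F 2) = b ∧
      inner ℝ (F 2) (a • F 0 + b • F 1 + c • F 2) = c := by
  simp [inner_add_right, inner_smul_right, F.inner_eq_ite]

theorem inner_polarPoint_zero (s ε : ℝ) : inner ℝ (F 0) (polarPoint F s ε : E3) = cos ε := by
  rw [coe_polarPoint, (inner_combination F _ _ _).1]

theorem inner_polarPoint_one (s ε : ℝ) :
    inner ℝ (F 1) (polarPoint F s ε : E3) = sin ε * cos s := by
  rw [coe_polarPoint, (inner_combination F _ _ _).2.1]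

theorem inner_polarPoint_two (s ε : ℝ) :
    inner ℝ (F 2) (polarPoint F s ε : E3) = sin ε * sin s := by
  rw [coe_polarPoint, (inner_combination F _ _ _).2.2]

theorem continuous_polarPoint : Continuous (fun x : ℝ × ℝ => polarPoint F x.1 x.2) := by
  apply Continuous.subtype_mk
  unfold greatArc
  fun_prop

theorem eq_combination (x : E3) :
    x = inner ℝ (F 0) x • F 0 + inner ℝ (F 1) x • F 1 + inner ℝ (F 2) x • F 2 := by
  have h := F.sum_repr' x
  rw [Fin.sum_univ_three] at h
  exact h.symm

/-- The direction of the point `x` in polar coordinates. -/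
noncomputable def polarArg (x : E3) : ℝ := Complex.arg ⟨inner ℝ (F 1) x, inner ℝ (F 2) x⟩

theorem polarPoint_polarArg (x : S2) :
    polarPoint F (polarArg F x) (arccos (inner ℝ (F 0) (x : E3))) = x := by
  have hx : ‖(x : E3)‖ = 1 := norm_eq_of_mem_sphere x
  have hsum : inner ℝ (F 0) (x : E3) ^ 2 + inner ℝ (F 1) (x : E3) ^ 2 +
      inner ℝ (F 2) (x : E3) ^ 2 = 1 := by
    have h := F.sum_sq_norm_inner_right (x : E3)
    rw [Fin.sum_univ_three, hx] at h
    simpa using h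
  set z : ℂ := ⟨inner ℝ (F 1) (x : E3), inner ℝ (F 2) (x : E3)⟩ with hz
  have habs : |inner ℝ (F 0) (x : E3)| ≤ 1 := by
    rw [← sq_le_one_iff_abs_le_one]
    nlinarith [sq_nonneg (inner ℝ (F 1) (x : E3)), sq_nonneg (inner ℝ (F 2) (x : E3))]
  have hn : sin (arccos (inner ℝ (F 0) (x : E3))) = ‖z‖ := by
    rw [sin_arccos, Complex.norm_def, Complex.normSq_apply]
    congr 1
    simp only [hz]
    nlinarith
  apply Subtype.ext
  rw [coe_polarPoint, cos_arccos (abs_le.mp habs).1 (abs_le.mp habs).2, hn]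
  have h1 : ‖z‖ * cos (polarArg F x) = inner ℝ (F 1) (x : E3) := Complex.norm_mul_cos_arg z
  have h2 : ‖z‖ * sin (polarArg F x) = inner ℝ (F 2) (x : E3) := Complex.norm_mul_sin_arg z
  rw [h1, h2]
  exact (eq_combination F x).symm

theorem polarPoint_add_int_mul_two_pi (s ε : ℝ) (m : ℤ) :
    polarPoint F (s + m * (2 * π)) ε = polarPoint F s ε := by
  apply Subtype.ext
  rw [coe_polarPoint, coe_polarPoint, cos_add_int_mul_two_pi, sin_add_int_mul_two_pi]

theorem polarPoint_zero_right (s : ℝ) : (polarPoint F s 0 : E3) = F 0 := by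
  simp [coe_polarPoint]

end polar

/-! ### Sectors cut out by two rays. -/

theorem IsPreconnected.subset_interior_of_disjoint_frontier {X : Type*} [TopologicalSpace X]
    {s t : Set X} (hs : IsPreconnected s) (hd : Disjoint s (frontier t)) (hn : (s ∩ t).Nonempty) :
    s ⊆ interior t := by
  have hmem : ∀ x ∈ s, x ∈ closure t → x ∈ interior t := fun x hx hxt => by
    by_contra hxi
    exact disjoint_left.mp hd hx ⟨hxt, hxi⟩
  obtain ⟨x, hxs, hxt⟩ := hn
  apply hs.subset_left_of_subset_union isOpen_interior isClosed_closure.isOpen_compl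
    (disjoint_compl_right.mono_left interior_subset_closure)
  · intro y hy
    by_cases h : y ∈ closure t
    · exact Or.inl (hmem y hy h)
    · exact Or.inr h
  · exact ⟨x, hxs, hmem x hxs (subset_closure hxt)⟩

section sector

variable (F : OrthonormalBasis (Fin 3) ℝ E3)

theorem exists_polarPoint_eq (x : S2) : ∃ s ∈ Ico 0 (2 * π),
    x = polarPoint F s (arccos (inner ℝ (F 0) (x : E3))) := by
  obtain ⟨s, hs, m, hm⟩ : ∃ s ∈ Ico 0 (2 * π), ∃ m : ℤ, polarArg F x = s + m * (2 * π) := by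
    refine ⟨toIcoMod two_pi_pos 0 (polarArg F x), ?_, toIcoDiv two_pi_pos 0 (polarArg F x), ?_⟩
    · simpa using toIcoMod_mem_Ico two_pi_pos 0 (polarArg F x)
    · rw [← zsmul_eq_mul, toIcoMod_add_toIcoDiv_zsmul]
  refine ⟨s, hs, ?_⟩
  rw [← polarPoint_add_int_mul_two_pi F s _ m, ← hm, polarPoint_polarArg]

/-- A closed set whose frontier, close to the point `F 0`, consists of two rays in the directions
`0` and `θ`, is close to `F 0` the sector between these rays that it meets. -/
theorem sector_of_frontier {R : Set S2} (hR : IsClosed R) {θ ε₀ : ℝ} (hθ : θ ∈ Ioo 0 (2 * π))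
    (hε : ε₀ ∈ Ioc 0 (π / 2))
    (hfr : ∀ s ∈ Ioo 0 (2 * π), s ≠ θ → ∀ ε ∈ Ioo 0 ε₀, polarPoint F s ε ∉ frontier R)
    (hv : ∀ x : S2, (x : E3) = F 0 → x ∈ frontier R)
    (hmeet : ∃ s ∈ Ioo 0 θ, ∃ ε ∈ Ioo 0 ε₀, polarPoint F s ε ∈ R) :
    (∀ s ∈ Ioo 0 θ, ∀ ε ∈ Ioo 0 ε₀, polarPoint F s ε ∈ interior R) ∧
      ∀ s ∈ Ioo θ (2 * π), ∀ ε ∈ Ioo 0 ε₀, polarPoint F s ε ∉ R := by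
  -- Each of the two open sectors is connected and avoids the frontier, so it lies inside `R` as
  -- soon as it meets `R`.
  have key : ∀ a b : ℝ, 0 ≤ a → b ≤ 2 * π → θ ∉ Ioo a b →
      (∃ s ∈ Ioo a b, ∃ ε ∈ Ioo 0 ε₀, polarPoint F s ε ∈ R) →
      ∀ s ∈ Ioo a b, ∀ ε ∈ Ioo 0 ε₀, polarPoint F s ε ∈ interior R := by
    intro a b ha hb hab hex s hs ε hε'
    have hpre : IsPreconnected ((fun x : ℝ × ℝ => polarPoint F x.1 x.2) ''
        (Ioo a b ×ˢ Ioo 0 ε₀)) :=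
      (isPreconnected_Ioo.prod isPreconnected_Ioo).image _ (continuous_polarPoint F).continuousOn
    apply hpre.subset_interior_of_disjoint_frontier
    · rw [disjoint_left]
      rintro _ ⟨⟨s, ε⟩, ⟨hs, hε⟩, rfl⟩
      exact hfr s ⟨ha.trans_lt hs.1, hs.2.trans_le hb⟩ (fun h => hab (h ▸ hs)) ε hε
    · obtain ⟨s, hs, ε, hε, h⟩ := hex
      exact ⟨_, ⟨⟨s, ε⟩, ⟨hs, hε⟩, rfl⟩, h⟩
    · exact ⟨⟨s, ε⟩, ⟨hs, hε'⟩, rfl⟩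
  have h1 := key 0 θ le_rfl hθ.2.le (by simp) hmeet
  refine ⟨h1, ?_⟩
  intro s hs ε hε' hmem
  have h2 := key θ (2 * π) hθ.1.le le_rfl (by simp) ⟨s, hs, ε, hε', hmem⟩
  -- If the second sector met `R` as well, then `R`, being closed, would contain the whole disc, and
  -- its centre would not be a frontier point.
  have hall : ∀ s ∈ Ico 0 (2 * π), ∀ ε ∈ Ico 0 ε₀, polarPoint F s ε ∈ R := by
    have hsub : Ico 0 (2 * π) ×ˢ Ico 0 ε₀ ⊆
        closure ((Ioo 0 θ ∪ Ioo θ (2 * π)) ×ˢ Ioo 0 ε₀) := by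
      rw [closure_prod_eq, closure_union, closure_Ioo hθ.1.ne, closure_Ioo hθ.2.ne,
        closure_Ioo hε.1.ne, Icc_union_Icc_eq_Icc hθ.1.le hθ.2.le]
      exact prod_mono Ico_subset_Icc_self Ico_subset_Icc_self
    intro s hs ε hε'
    have hcl := hsub (mk_mem_prod hs hε')
    have hmap : MapsTo (fun x : ℝ × ℝ => polarPoint F x.1 x.2)
        ((Ioo 0 θ ∪ Ioo θ (2 * π)) ×ˢ Ioo 0 ε₀) R := by
      rintro ⟨s, ε⟩ ⟨hs | hs, hε⟩
      · exact interior_subset (h1 s hs ε hε)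
      · exact interior_subset (h2 s hs ε hε)
    have := map_mem_closure (continuous_polarPoint F) hcl hmap
    rwa [hR.closure_eq] at this
  set x : S2 := polarPoint F 0 0 with hx
  have hx0 : (x : E3) = F 0 := polarPoint_zero_right F 0
  have hxi : x ∈ interior R := by
    rw [mem_interior]
    refine ⟨{y : S2 | cos ε₀ < inner ℝ (F 0) (y : E3)}, ?_, ?_, ?_⟩
    · intro y hy
      obtain ⟨s, hs, h⟩ := exists_polarPoint_eq F y
      rw [h]
      apply hall s hs
      refine ⟨arccos_nonneg _, ?_⟩
      have := arccos_lt_arccos (neg_one_le_cos _) hy ?_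
      · rwa [arccos_cos hε.1.le (by linarith [hε.2, pi_pos])] at this
      · have h1 := real_inner_le_norm (F 0) (y : E3)
        rwa [F.norm_eq_one, norm_eq_of_mem_sphere y, one_mul] at h1
    · exact isOpen_lt continuous_const (by fun_prop)
    · change cos ε₀ < inner ℝ (F 0) (x : E3)
      rw [hx0]
      simp only [real_inner_self_eq_norm_sq, F.norm_eq_one, one_pow]
      rw [← cos_zero]
      exact cos_lt_cos_of_nonneg_of_le_pi le_rfl (by linarith [hε.2, pi_pos]) hε.1
  exact (hv x hx0).2 hxi

/-- An arc may be longer than π and come back towards its start from the other side; `ε < 2 * π - L`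
keeps the point closer to the start than this return, so that equal distance means equal parameter.
-/
theorem polarPoint_notMem_arc {θ L s ε : ℝ} (hL : L < 2 * π) (hθ : θ ∈ Ico 0 (2 * π))
    (hs : s ∈ Ico 0 (2 * π)) (hsθ : s ≠ θ) (hε : ε ∈ Ioo 0 π) (hεL : ε < 2 * π - L) :
    polarPoint F s ε ∉ arc (F 0) (cos θ • F 1 + sin θ • F 2) L := by
  rintro ⟨t, ht, h⟩
  have h' : (polarPoint F s ε : E3) = (polarPoint F θ t : E3) := h
  have h0 : cos ε = cos t := by
    rw [← inner_polarPoint_zero F s, h', inner_polarPoint_zero]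
  have hεt : t = ε := by
    by_cases htπ : t ≤ π
    · exact (injOn_cos ⟨hε.1.le, hε.2.le⟩ ⟨ht.1, htπ⟩ h0).symm
    · exfalso
      have := injOn_cos (x₁ := ε) (x₂ := 2 * π - t) ⟨hε.1.le, hε.2.le⟩
        ⟨by linarith [ht.2], by linarith⟩ (by simp only [cos_two_pi_sub, h0])
      linarith [ht.2]
  subst hεt
  have hsin : sin t ≠ 0 := (sin_pos_of_pos_of_lt_pi hε.1 hε.2).ne'
  apply hsθ
  apply eq_of_cos_eq_of_sin_eq hs hθ
  · apply mul_left_cancel₀ hsin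
    rw [← inner_polarPoint_one F, h', inner_polarPoint_one]
  · apply mul_left_cancel₀ hsin
    rw [← inner_polarPoint_two F, h', inner_polarPoint_two]

/-- A point to the left of the ray in direction `0`, close to the ray, has a small positive polar
angle. -/
theorem exists_polarPoint_left {t θ ε₀ : ℝ} (ht : t ∈ Ioo 0 ε₀) (hε₀ : ε₀ ≤ π / 2) (hθ : 0 < θ) :
    ∀ᶠ ε in 𝓝[>] (0 : ℝ), ∃ s ∈ Ioo 0 θ, ∃ r ∈ Ioo 0 ε₀,
      (polarPoint F s r : E3) = greatArc (greatArc (F 0) (F 1) t) (F 2) ε := by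
  have hpos : 0 < sin t := sin_pos_of_pos_of_lt_pi ht.1 (by linarith [ht.2, pi_pos])
  have hcos : 0 < cos t := cos_pos_of_mem_Ioo ⟨by linarith [ht.1, pi_pos], by linarith [ht.2]⟩
  have hcomb : ∀ ε, greatArc (greatArc (F 0) (F 1) t) (F 2) ε =
      (cos ε * cos t) • F 0 + (cos ε * sin t) • F 1 + sin ε • F 2 := by
    intro ε
    simp only [greatArc]
    module
  have hu : ∀ᶠ ε in 𝓝[>] (0 : ℝ), ε ∈ Ioo 0 (π / 2) := Ioo_mem_nhdsGT (by positivity)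
  have harc : ∀ᶠ ε in 𝓝[>] (0 : ℝ), arccos (cos ε * cos t) < ε₀ := by
    apply nhdsWithin_le_nhds
    have hc : Continuous fun ε : ℝ => arccos (cos ε * cos t) := by fun_prop
    apply hc.continuousAt.eventually_lt continuousAt_const
    rw [cos_zero, one_mul, arccos_cos ht.1.le (by linarith [ht.2, pi_pos])]
    exact ht.2
  have harg : ∀ᶠ ε in 𝓝[>] (0 : ℝ), Complex.arg ⟨cos ε * sin t, sin ε⟩ < θ := by
    apply nhdsWithin_le_nhds
    have hc : ContinuousAt (fun ε : ℝ => Complex.arg ⟨cos ε * sin t, sin ε⟩) 0 := by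
      have hg : ContinuousAt (fun ε : ℝ => (⟨cos ε * sin t, sin ε⟩ : ℂ)) 0 := by
        have : (fun ε : ℝ => (⟨cos ε * sin t, sin ε⟩ : ℂ)) =
            fun ε : ℝ => ((cos ε * sin t : ℝ) : ℂ) + ((sin ε : ℝ) : ℂ) * Complex.I := by
          funext ε
          exact Complex.mk_eq_add_mul_I _ _
        rw [this]
        fun_prop
      refine ContinuousAt.comp (g := Complex.arg) (Complex.continuousAt_arg ?_) hg
      rw [Complex.mem_slitPlane_iff]
      left
      simpa using hpos
    apply hc.eventually_lt continuousAt_const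
    have h0 : Complex.arg ⟨cos 0 * sin t, sin 0⟩ = 0 := by
      rw [Complex.arg_eq_zero_iff]
      simp [hpos.le]
    rw [h0]
    exact hθ
  filter_upwards [hu, harc, harg] with ε h1 h2 h3
  set x := greatArc (greatArc (F 0) (F 1) t) (F 2) ε with hx
  have hx0 : inner ℝ (F 0) x = cos ε * cos t := by rw [hx, hcomb, (inner_combination F _ _ _).1]
  have hx1 : inner ℝ (F 1) x = cos ε * sin t := by
    rw [hx, hcomb, (inner_combination F _ _ _).2.1]
  have hx2 : inner ℝ (F 2) x = sin ε := by rw [hx, hcomb, (inner_combination F _ _ _).2.2]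
  have hsε : 0 < sin ε := sin_pos_of_pos_of_lt_pi h1.1 (by linarith [h1.2, pi_pos])
  have hxn : ‖x‖ = 1 := by
    apply norm_greatArc
    · exact norm_greatArc (by simp) (by simp) (F.orthonormal.inner_eq_zero (by decide)) _
    · simp
    · rw [greatArc, inner_add_left, inner_smul_left, inner_smul_left,
        F.orthonormal.inner_eq_zero (by decide), F.orthonormal.inner_eq_zero (by decide)]
      simp
  refine ⟨polarArg F x, ⟨?_, ?_⟩, arccos (inner ℝ (F 0) x), ⟨?_, ?_⟩, ?_⟩
  · have hnn : 0 ≤ polarArg F x := by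
      rw [polarArg, Complex.arg_nonneg_iff, hx2]
      exact hsε.le
    apply hnn.lt_of_ne'
    rw [polarArg, Ne, Complex.arg_eq_zero_iff, hx2]
    exact fun h => hsε.ne' h.2
  · rw [polarArg, hx1, hx2]
    exact h3
  · rw [arccos_pos, hx0]
    have : cos t < 1 := by
      rw [← cos_zero]
      exact cos_lt_cos_of_nonneg_of_le_pi le_rfl (by linarith [ht.2, pi_pos]) ht.1
    nlinarith [cos_le_one ε]
  · rw [hx0]
    exact h2
  · exact congrArg Subtype.val (polarPoint_polarArg F ⟨x, by simpa using hxn⟩)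

end sector

/-! ### Frames at the vertices, and the edges of the four-sided path. -/

theorem norm_cross_of_orthonormal {x y : E3} (hx : ‖x‖ = 1) (hy : ‖y‖ = 1)
    (hxy : inner ℝ x y = 0) : ‖cross x y‖ = 1 := by
  have hx' : x 0 ^ 2 + x 1 ^ 2 + x 2 ^ 2 = 1 := by
    have h := real_inner_self_eq_norm_sq x
    rw [hx, PiLp.inner_apply, Fin.sum_univ_three] at h
    simpa using h
  have hy' : y 0 ^ 2 + y 1 ^ 2 + y 2 ^ 2 = 1 := by
    have h := real_inner_self_eq_norm_sq y
    rw [hy, PiLp.inner_apply, Fin.sum_univ_three] at h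
    simpa using h
  have hxy' : x 0 * y 0 + x 1 * y 1 + x 2 * y 2 = 0 := by
    have h := hxy
    rw [real_inner_comm] at h
    simpa [PiLp.inner_apply, Fin.sum_univ_three] using h
  have h : ‖cross x y‖ ^ 2 = 1 := by
    rw [← real_inner_self_eq_norm_sq]
    simp only [cross, PiLp.inner_apply, Fin.sum_univ_three, cross_apply]
    simp
    linear_combination (x 0 ^ 2 + x 1 ^ 2 + x 2 ^ 2) * hy' + hx' -
      (x 0 * y 0 + x 1 * y 1 + x 2 * y 2) * hxy'
  nlinarith [norm_nonneg (cross x y)]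

theorem inner_cross_left (x y : E3) : inner ℝ x (cross x y) = 0 := by
  simp only [cross, PiLp.inner_apply, Fin.sum_univ_three, cross_apply]
  simp
  ring

theorem inner_cross_right (x y : E3) : inner ℝ y (cross x y) = 0 := by
  simp only [cross, PiLp.inner_apply, Fin.sum_univ_three, cross_apply]
  simp
  ring

namespace GeodesicFourPath

variable (P : GeodesicFourPath)

theorem norm_vertex (k : Fin 4) : ‖(P.vertex k : E3)‖ = 1 := norm_eq_of_mem_sphere _

theorem exists_frame (k : Fin 4) : ∃ F : OrthonormalBasis (Fin 3) ℝ E3,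
    F 0 = P.vertex k ∧ F 1 = P.dir k ∧ F 2 = P.leftNormal k := by
  have hv : Orthonormal ℝ (univ.domRestrict
      ![(P.vertex k : E3), P.dir k, P.leftNormal k]) := by
    have h1 := P.dir_tangent k
    have h2 := inner_cross_left (P.vertex k) (P.dir k)
    have h3 := inner_cross_right (P.vertex k) (P.dir k)
    constructor
    · rintro ⟨i, -⟩
      fin_cases i
      · exact P.norm_vertex k
      · exact P.norm_dir k
      · exact norm_cross_of_orthonormal (P.norm_vertex k) (P.norm_dir k) h1
    · rintro ⟨i, hi⟩ ⟨j, hj⟩ hij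
      have hij : i ≠ j := fun h => hij (by subst h; rfl)
      fin_cases i <;> fin_cases j <;> first | exact absurd rfl hij | skip
      · exact h1
      · exact h2
      · exact (real_inner_comm _ _).trans h1
      · exact h3
      · exact (real_inner_comm _ _).trans h2
      · exact (real_inner_comm _ _).trans h3
  obtain ⟨F, hF⟩ := hv.exists_orthonormalBasis_extension_of_card_eq (by simp)
  exact ⟨F, hF 0 trivial, hF 1 trivial, hF 2 trivial⟩

theorem norm_leftNormal (k : Fin 4) : ‖P.leftNormal k‖ = 1 :=
  norm_cross_of_orthonormal (P.norm_vertex k) (P.norm_dir k) (P.dir_tangent k)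

theorem edge_eq_arc (k : Fin 4) : P.edge k = arc (P.vertex k) (P.dir k) (P.len k) := rfl

theorem isClosed_edge (k : Fin 4) : IsClosed (P.edge k) := isClosed_arc _ _ _

theorem start_mem_edge (k : Fin 4) : P.vertex k ∈ P.edge k :=
  ⟨0, ⟨le_rfl, (P.len_pos k).le⟩, by simp⟩

theorem end_mem_edge (k : Fin 4) : P.vertex (k + 1) ∈ P.edge k :=
  ⟨P.len k, ⟨(P.len_pos k).le, le_rfl⟩, (P.closed k).symm⟩

theorem vertex_injective : Function.Injective P.vertex := by
  intro k l h
  exact (P.simple k l 0 0 ⟨le_rfl, P.len_pos k⟩ ⟨le_rfl, P.len_pos l⟩ (by simp [h])).1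

/-- A full turn returns to the starting vertex, contradicting simplicity or the distinctness of the
vertices. -/
theorem len_lt (k : Fin 4) : P.len k < 2 * π := by
  by_contra! h
  have hper : greatArc (P.vertex k) (P.dir k) (2 * π) = P.vertex k := by simp [greatArc]
  rcases h.eq_or_lt with h | h
  · have := P.closed k
    rw [← h, hper] at this
    have := P.vertex_injective (Subtype.ext this)
    simp at this
  · have := (P.simple k k 0 (2 * π) ⟨le_rfl, P.len_pos k⟩ ⟨by positivity, h⟩ (by simp [hper])).2
    linarith [pi_pos]

theorem eq_of_interior {k l : Fin 4} {s t : ℝ} (ht : t ∈ Ioo 0 (P.len k))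
    (hs : s ∈ Icc 0 (P.len l))
    (h : greatArc (P.vertex k) (P.dir k) t = greatArc (P.vertex l) (P.dir l) s) :
    k = l ∧ t = s := by
  rcases hs.2.eq_or_lt with h' | h'
  · rw [h', P.closed l, ← greatArc_zero (P.vertex (l + 1) : E3) (P.dir (l + 1))] at h
    have := (P.simple _ _ t 0 ⟨ht.1.le, ht.2⟩ ⟨le_rfl, P.len_pos _⟩ h).2
    exact absurd this ht.1.ne'
  · exact P.simple k l t s ⟨ht.1.le, ht.2⟩ ⟨hs.1, h'⟩ h

theorem vertex_mem_edge {k l : Fin 4} (h : P.vertex k ∈ P.edge l) : l = k ∨ l + 1 = k := by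
  obtain ⟨s, hs, h⟩ := h
  rcases hs.2.eq_or_lt with h' | h'
  · right
    rw [h', P.closed l] at h
    exact (P.vertex_injective (Subtype.ext h)).symm
  · left
    exact (P.simple k l 0 s ⟨le_rfl, P.len_pos k⟩ ⟨hs.1, h'⟩ (by simpa using h)).1.symm

theorem exists_interior_point (k : Fin 4) : ∃ x : S2, ∃ t ∈ Ioo 0 (P.len k),
    (x : E3) = greatArc (P.vertex k) (P.dir k) t :=
  ⟨⟨greatArc (P.vertex k) (P.dir k) (P.len k / 2), by
    simp [norm_greatArc (P.norm_vertex k) (P.norm_dir k) (P.dir_tangent k)]⟩, P.len k / 2,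
    ⟨by linarith [P.len_pos k], by linarith [P.len_pos k]⟩, rfl⟩

theorem edge_injective : Function.Injective P.edge := by
  intro k l h
  obtain ⟨x, t, ht, hx⟩ := P.exists_interior_point k
  have hxl : x ∈ P.edge l := h ▸ ⟨t, ⟨ht.1.le, ht.2.le⟩, hx⟩
  obtain ⟨s, hs, hx'⟩ := hxl
  exact (P.eq_of_interior ht hs (hx.symm.trans hx')).1

theorem edge_eq_arc_backDir (k : Fin 4) :
    P.edge k = arc (P.vertex (k + 1)) (P.backDir k) (P.len k) := by
  rw [edge_eq_arc, ← arc_reverse, P.closed k]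
  rfl

end GeodesicFourPath

/-! ### The quadrilateral near a vertex, and its images under isometries. -/

namespace SphericalQuadrilateral

variable (Q : SphericalQuadrilateral)

theorem isClosed_region : IsClosed Q.region := by
  rw [← Q.closure_interior_region]
  exact isClosed_closure

theorem edge_subset_region (k : Fin 4) : Q.edge k ⊆ Q.region := by
  rw [← Q.isClosed_region.closure_eq]
  refine (subset_iUnion Q.edge k).trans ?_
  rw [← Q.frontier_region]
  exact frontier_subset_closure

/-- This connects `angle`, defined by tangent vectors, with the region. Near the vertex the frontier
consists of the outgoing edge in direction 0 and the incoming edge in direction `angle k`;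
`region_left` tells which of the two sectors is inside. -/
theorem sector_at_vertex (k : Fin 4) {F : OrthonormalBasis (Fin 3) ℝ E3}
    (h0 : F 0 = Q.vertex k) (h1 : F 1 = Q.dir k) (h2 : F 2 = Q.leftNormal k) :
    ∃ ε₀ > 0, (∀ s ∈ Ioo 0 (Q.angle k), ∀ ε ∈ Ioo 0 ε₀, polarPoint F s ε ∈ interior Q.region) ∧
      ∀ s ∈ Ioo (Q.angle k) (2 * π), ∀ ε ∈ Ioo 0 ε₀, polarPoint F s ε ∉ Q.region := by
  obtain ⟨j, rfl⟩ : ∃ j, k = j + 1 := ⟨k - 1, by simp⟩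
  have hout : Q.edge (j + 1) = arc (F 0) (cos 0 • F 1 + sin 0 • F 2) (Q.len (j + 1)) := by
    simp [GeodesicFourPath.edge_eq_arc, h0, h1]
  have hin : Q.edge j = arc (F 0) (cos (Q.angle (j + 1)) • F 1 + sin (Q.angle (j + 1)) • F 2)
      (Q.len j) := by
    rw [GeodesicFourPath.edge_eq_arc_backDir, Q.angle_spec, h0, h1, h2]
  obtain ⟨ε₁, hε₁, hfar⟩ : ∃ ε₁ > 0, ∀ s, ∀ ε ∈ Ioo 0 ε₁, ∀ l, l ≠ j → l ≠ j + 1 →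
      polarPoint F s ε ∉ Q.edge l := by
    have hopen : IsOpen (⋂ l ∈ {l | l ≠ j ∧ l ≠ j + 1}, (Q.edge l)ᶜ) :=
      (toFinite _).isOpen_biInter fun l _ => (Q.isClosed_edge l).isOpen_compl
    have hmem : Q.vertex (j + 1) ∈ ⋂ l ∈ {l | l ≠ j ∧ l ≠ j + 1}, (Q.edge l)ᶜ := by
      simp only [mem_iInter, mem_ofPred_eq, mem_compl_iff]
      rintro l ⟨hl1, hl2⟩ h
      rcases Q.vertex_mem_edge h with h | h
      · exact hl2 h
      · exact hl1 (add_right_cancel h)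
    obtain ⟨δ, hδ, hball⟩ := Metric.isOpen_iff.mp hopen _ hmem
    refine ⟨δ, hδ, fun s ε hε l hl1 hl2 hl => ?_⟩
    have : polarPoint F s ε ∈ Metric.ball (Q.vertex (j + 1)) δ := by
      rw [Metric.mem_ball, Subtype.dist_eq, ← h0, dist_eq_norm]
      have hsq : ‖(polarPoint F s ε : E3) - F 0‖ ^ 2 ≤ ε ^ 2 := by
        rw [norm_sub_sq_real, real_inner_comm, inner_polarPoint_zero, F.norm_eq_one,
          norm_eq_of_mem_sphere]
        nlinarith [one_sub_sq_div_two_le_cos (x := ε)]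
      exact (abs_le_of_sq_le_sq' hsq hε.1.le).2.trans_lt hε.2
    have := hball this
    simp only [mem_iInter] at this
    exact this l ⟨hl1, hl2⟩ hl
  -- The bound ε₁ avoids the two edges not at the vertex, the bounds 2π − len avoid the far ends of
  -- long adjoining edges, and the last bound puts the point at parameter ε₀/2 inside the outgoing
  -- edge.
  set ε₀ := min (min ε₁ (π / 2)) (min (2 * π - Q.len j)
    (min (2 * π - Q.len (j + 1)) (Q.len (j + 1)))) with hε₀
  have hε₀pos : 0 < ε₀ := by
    have := Q.len_lt j
    have := Q.len_lt (j + 1)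
    exact lt_min (lt_min hε₁ (by positivity))
      (lt_min (by linarith) (lt_min (by linarith) (Q.len_pos _)))
  have hle1 : ε₀ ≤ ε₁ := (min_le_left _ _).trans (min_le_left _ _)
  have hle2 : ε₀ ≤ π / 2 := (min_le_left _ _).trans (min_le_right _ _)
  have hle3 : ε₀ ≤ 2 * π - Q.len j := (min_le_right _ _).trans (min_le_left _ _)
  have hle4 : ε₀ ≤ 2 * π - Q.len (j + 1) :=
    ((min_le_right _ _).trans (min_le_right _ _)).trans (min_le_left _ _)
  have hle5 : ε₀ ≤ Q.len (j + 1) :=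
    ((min_le_right _ _).trans (min_le_right _ _)).trans (min_le_right _ _)
  refine ⟨ε₀, hε₀pos, ?_⟩
  apply sector_of_frontier F Q.isClosed_region ⟨Q.angle_pos _, Q.angle_lt _⟩ ⟨hε₀pos, hle2⟩
  · intro s hs hsθ ε hε hmem
    rw [Q.frontier_region] at hmem
    obtain ⟨l, hl⟩ := mem_iUnion.mp hmem
    have hεπ : ε ∈ Ioo 0 π := ⟨hε.1, by linarith [hε.2, pi_pos]⟩
    by_cases hlj : l = j
    · rw [hlj, hin] at hl
      exact polarPoint_notMem_arc F (Q.len_lt j) ⟨(Q.angle_pos _).le, Q.angle_lt _⟩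
        ⟨hs.1.le, hs.2⟩ hsθ hεπ (hε.2.trans_le hle3) hl
    by_cases hlj' : l = j + 1
    · rw [hlj', hout] at hl
      exact polarPoint_notMem_arc F (Q.len_lt _) ⟨le_rfl, two_pi_pos⟩
        ⟨hs.1.le, hs.2⟩ hs.1.ne' hεπ (hε.2.trans_le hle4) hl
    · exact hfar s ε ⟨hε.1, hε.2.trans_le hle1⟩ l hlj hlj' hl
  · intro x hx
    rw [h0] at hx
    rw [Q.frontier_region, Subtype.ext hx]
    exact mem_iUnion.mpr ⟨_, Q.start_mem_edge _⟩
  · have hleft := Q.region_left (j + 1) (ε₀ / 2) ⟨by linarith, by linarith⟩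
    rw [← h0, ← h1, ← h2] at hleft
    obtain ⟨ε, ⟨s, hs, r, hr, hsr⟩, y, hy, hy'⟩ :=
      ((exists_polarPoint_left F (t := ε₀ / 2) ⟨by linarith, by linarith⟩ hle2
        (Q.angle_pos (j + 1))).and hleft).exists
    refine ⟨s, hs, r, hr, ?_⟩
    rwa [← Subtype.ext (hy'.trans hsr.symm)]

end SphericalQuadrilateral

@[simp] theorem coe_sphereMap (g : E3 ≃ₗᵢ[ℝ] E3) (x : S2) : (sphereMap g x : E3) = g x := rfl

/-- The action of a linear isometry on the unit sphere, as a homeomorphism. -/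
noncomputable def sphereHomeo (g : E3 ≃ₗᵢ[ℝ] E3) : S2 ≃ₜ S2 where
  toFun := sphereMap g
  invFun := sphereMap g.symm
  left_inv x := Subtype.ext (by simp)
  right_inv x := Subtype.ext (by simp)
  continuous_toFun := (g.continuous.comp continuous_subtype_val).subtype_mk _
  continuous_invFun := (g.symm.continuous.comp continuous_subtype_val).subtype_mk _

@[simp] theorem coe_sphereHomeo (g : E3 ≃ₗᵢ[ℝ] E3) : ⇑(sphereHomeo g) = sphereMap g := rfl

theorem sphereMap_injective (g : E3 ≃ₗᵢ[ℝ] E3) : Function.Injective (sphereMap g) :=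
  (sphereHomeo g).injective

theorem sphereMap_polarPoint (g : E3 ≃ₗᵢ[ℝ] E3) (F : OrthonormalBasis (Fin 3) ℝ E3) (s ε : ℝ) :
    sphereMap g (polarPoint F s ε) = polarPoint (F.map g) s ε := by
  apply Subtype.ext
  simp [coe_polarPoint]

namespace SphericalQuadrilateral

variable (Q : SphericalQuadrilateral) (g : E3 ≃ₗᵢ[ℝ] E3)

theorem interior_tileAt : interior (Q.tileAt g) = sphereMap g '' interior Q.region :=
  ((sphereHomeo g).image_interior _).symm

theorem frontier_tileAt : frontier (Q.tileAt g) = ⋃ k, Q.edgeAt g k := by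
  have h := (sphereHomeo g).image_frontier Q.region
  rw [coe_sphereHomeo, Q.frontier_region, image_iUnion] at h
  exact h.symm

theorem closure_interior_tileAt : closure (interior (Q.tileAt g)) = Q.tileAt g := by
  have h := (sphereHomeo g).image_closure (interior Q.region)
  rw [coe_sphereHomeo, Q.closure_interior_region] at h
  rw [interior_tileAt, ← h]
  rfl

theorem isClosed_tileAt : IsClosed (Q.tileAt g) := by
  rw [← closure_interior_tileAt]
  exact isClosed_closure

theorem edgeAt_subset_tileAt (k : Fin 4) : Q.edgeAt g k ⊆ Q.tileAt g :=
  image_mono (Q.edge_subset_region k)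

theorem edgeAt_eq_arc (k : Fin 4) :
    Q.edgeAt g k = arc (Q.cornerAt g k) (g (Q.dir k)) (Q.len k) := by
  ext x
  constructor
  · rintro ⟨y, ⟨t, ht, hy⟩, rfl⟩
    exact ⟨t, ht, by rw [coe_sphereMap, hy, map_greatArc]; rfl⟩
  · rintro ⟨t, ht, hx⟩
    refine ⟨sphereMap g.symm x, ⟨t, ht, ?_⟩, (sphereHomeo g).apply_symm_apply x⟩
    rw [coe_sphereMap, hx, map_greatArc]
    simp [cornerAt]

theorem cornerAt_injective : Function.Injective (Q.cornerAt g) :=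
  (sphereMap_injective g).comp Q.vertex_injective

theorem edgeAt_injective : Function.Injective (Q.edgeAt g) := fun _ _ h =>
  Q.edge_injective ((sphereMap_injective g).image_injective h)

theorem start_mem_edgeAt (k : Fin 4) : Q.cornerAt g k ∈ Q.edgeAt g k :=
  mem_image_of_mem _ (Q.start_mem_edge k)

theorem end_mem_edgeAt (k : Fin 4) : Q.cornerAt g (k + 1) ∈ Q.edgeAt g k :=
  mem_image_of_mem _ (Q.end_mem_edge k)

/-- The frame is carried along by `g`, so mirror images need no separate treatment. -/
theorem sector_at_cornerAt (k : Fin 4) : ∃ F : OrthonormalBasis (Fin 3) ℝ E3,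
    F 0 = Q.cornerAt g k ∧ ∃ ε₀ > 0,
      (∀ s ∈ Ioo 0 (Q.angle k), ∀ ε ∈ Ioo 0 ε₀, polarPoint F s ε ∈ interior (Q.tileAt g)) ∧
        ∀ s ∈ Ioo (Q.angle k) (2 * π), ∀ ε ∈ Ioo 0 ε₀, polarPoint F s ε ∉ Q.tileAt g := by
  obtain ⟨F, h0, h1, h2⟩ := Q.exists_frame k
  obtain ⟨ε₀, hε₀, hin, hout⟩ := Q.sector_at_vertex k h0 h1 h2
  refine ⟨F.map g, by simp [h0, cornerAt], ε₀, hε₀, ?_, ?_⟩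
  · intro s hs ε hε
    rw [interior_tileAt, ← sphereMap_polarPoint]
    exact mem_image_of_mem _ (hin s hs ε hε)
  · intro s hs ε hε h
    rw [← sphereMap_polarPoint] at h
    exact hout s hs ε hε ((sphereMap_injective g).mem_set_image.mp h)

end SphericalQuadrilateral

/-- A unit vector orthogonal to two linearly independent vectors of three-space is unique up to
sign. -/
theorem eq_or_eq_neg_of_inner_eq_zero {x u n n' : E3} (hx : ‖x‖ = 1) (hu : ‖u‖ = 1)
    (hxu : inner ℝ x u = 0) (hn : ‖n‖ = 1) (hxn : inner ℝ x n = 0) (hun : inner ℝ u n = 0)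
    (hn' : ‖n'‖ = 1) (hxn' : inner ℝ x n' = 0) (hun' : inner ℝ u n' = 0) : n' = n ∨ n' = -n := by
  have hv : Orthonormal ℝ (univ.domRestrict ![x, u, n]) := by
    constructor
    · rintro ⟨i, -⟩
      fin_cases i
      · exact hx
      · exact hu
      · exact hn
    · rintro ⟨i, hi⟩ ⟨j, hj⟩ hij
      have hij : i ≠ j := fun h => hij (by subst h; rfl)
      fin_cases i <;> fin_cases j <;> first | exact absurd rfl hij | skip
      · exact hxu
      · exact hxn
      · exact (real_inner_comm _ _).trans hxu
      · exact hun
      · exact (real_inner_comm _ _).trans hxn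
      · exact (real_inner_comm _ _).trans hun
  obtain ⟨F, hF⟩ := hv.exists_orthonormalBasis_extension_of_card_eq (by simp)
  have h0 : F 0 = x := hF 0 trivial
  have h1 : F 1 = u := hF 1 trivial
  have h2 : F 2 = n := hF 2 trivial
  have h := eq_combination F n'
  rw [h0, h1, h2, hxn', hun', zero_smul, zero_smul, zero_add, zero_add] at h
  have habs := congrArg norm h
  rw [norm_smul, hn, hn', mul_one, Real.norm_eq_abs] at habs
  rcases eq_or_eq_neg_of_abs_eq habs.symm with h' | h'
  · left; rw [h, h', one_smul]
  · right; rw [h, h', neg_smul, one_smul]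

/-! ### How tiles meet along edges and at corners. -/

namespace SphereTiling

variable {Q : SphericalQuadrilateral} {f : ℕ} (T : SphereTiling Q f)

/-- The tile `i`, as a closed set. -/
noncomputable def tile (i : Fin f) : Set S2 := Q.tileAt (T.place i)

theorem corner_injective (i : Fin f) : Function.Injective (T.corner i) :=
  Q.cornerAt_injective _

theorem edge_injective (i : Fin f) : Function.Injective (T.edge i) := Q.edgeAt_injective _

theorem isClosed_tile (i : Fin f) : IsClosed (T.tile i) := Q.isClosed_tileAt _

theorem frontier_tile (i : Fin f) : frontier (T.tile i) = ⋃ k, T.edge i k := Q.frontier_tileAt _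

theorem exists_mem_tile (x : S2) : ∃ i, x ∈ T.tile i := by
  have h : x ∈ ⋃ i, Q.tileAt (T.place i) := T.cover ▸ mem_univ x
  exact mem_iUnion.mp h

/-- A tile is the closure of its interior, so an open set that meets it also meets its interior. -/
theorem notMem_interior_of_mem {i j : Fin f} (hij : i ≠ j) {x : S2} (hx : x ∈ T.tile i) :
    x ∉ interior (T.tile j) := by
  intro hxj
  rw [tile, ← Q.closure_interior_tileAt] at hx
  obtain ⟨y, hy, hy'⟩ := _root_.mem_closure_iff.mp hx _ isOpen_interior hxj
  exact disjoint_left.mp (T.nonoverlapping i j hij) hy' hy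

theorem mem_frontier_of_mem {i j : Fin f} (hij : i ≠ j) {x : S2} (hx : x ∈ T.tile i)
    (hxj : x ∈ T.tile j) : x ∈ frontier (T.tile j) := by
  rw [(T.isClosed_tile j).frontier_eq]
  exact ⟨hxj, T.notMem_interior_of_mem hij hx⟩

theorem mem_tile_of_mem_edge {i : Fin f} {k : Fin 4} {x : S2} (hx : x ∈ T.edge i k) :
    x ∈ T.tile i := Q.edgeAt_subset_tileAt _ k hx

theorem corner_mem_tile (i : Fin f) (k : Fin 4) : T.corner i k ∈ T.tile i :=
  T.mem_tile_of_mem_edge (Q.start_mem_edgeAt _ k)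

/-- The other tiles have a closed union that contains the complement of this one, hence also the
closure of the complement. -/
theorem exists_other_tile {i : Fin f} {x : S2} (hx : x ∈ frontier (T.tile i)) :
    ∃ j ≠ i, x ∈ T.tile j := by
  have hcl : IsClosed (⋃ j ∈ {j | j ≠ i}, T.tile j) :=
    (toFinite _).isClosed_biUnion fun j _ => T.isClosed_tile j
  have hsub : (T.tile i)ᶜ ⊆ ⋃ j ∈ {j | j ≠ i}, T.tile j := by
    intro y hy
    obtain ⟨j, hj⟩ := T.exists_mem_tile y
    refine mem_biUnion (x := j) ?_ hj
    rintro rfl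
    exact hy hj
  have hx' : x ∈ closure (T.tile i)ᶜ := by
    rw [frontier_eq_closure_inter_closure] at hx
    exact hx.2
  have := closure_minimal hsub hcl hx'
  simpa using this

/-- Edges of tiles coincide, or meet at most in common end points. -/
theorem edge_eq_or (i j : Fin f) (k l : Fin 4) {x : S2} (hx : x ∈ T.edge i k)
    (hx' : x ∈ T.edge j l) : T.edge i k = T.edge j l ∨
      ((x = T.corner i k ∨ x = T.corner i (k + 1)) ∧
        (x = T.corner j l ∨ x = T.corner j (l + 1))) := by
  rcases T.edge_to_edge i j k l with h | h
  · exact Or.inl h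
  · right
    exact h ⟨hx, hx'⟩

/-- Every edge of a tile is shared with another tile. -/
theorem exists_edge_eq (i : Fin f) (k : Fin 4) : ∃ j ≠ i, ∃ l, T.edge j l = T.edge i k := by
  obtain ⟨y, t, ht, hy⟩ := Q.exists_interior_point k
  have hyk : y ∈ Q.edge k := ⟨t, ⟨ht.1.le, ht.2.le⟩, hy⟩
  have hx : sphereMap (T.place i) y ∈ T.edge i k := mem_image_of_mem _ hyk
  obtain ⟨j, hj, hxj⟩ := T.exists_other_tile (i := i)
    (by rw [frontier_tile]; exact mem_iUnion.mpr ⟨k, hx⟩)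
  have hxf := T.mem_frontier_of_mem hj.symm (T.mem_tile_of_mem_edge hx) hxj
  rw [frontier_tile] at hxf
  obtain ⟨l, hl⟩ := mem_iUnion.mp hxf
  refine ⟨j, hj, l, ?_⟩
  rcases T.edge_eq_or i j k l hx hl with h | ⟨h, -⟩
  · exact h.symm
  · exfalso
    rcases h with h | h
    · have h := sphereMap_injective _ h
      rw [h] at hy
      exact ht.1.ne' (Q.eq_of_interior ht ⟨le_rfl, (Q.len_pos k).le⟩
        (hy.symm.trans (greatArc_zero _ _).symm)).2
    · have h := sphereMap_injective _ h
      rw [h, ← Q.closed k] at hy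
      exact ht.2.ne (Q.eq_of_interior ht ⟨(Q.len_pos k).le, le_rfl⟩ hy.symm).2

/-- Two coinciding edges have the same end points. -/
theorem corner_mem_of_edge_eq {i j : Fin f} {k l : Fin 4} (h : T.edge i k = T.edge j l) :
    (T.corner i k = T.corner j l ∨ T.corner i k = T.corner j (l + 1)) ∧
      (T.corner i (k + 1) = T.corner j l ∨ T.corner i (k + 1) = T.corner j (l + 1)) := by
  constructor
  -- The adjacent edge of tile `i` also contains this corner but is not the shared edge, so
  -- edge-to-edge makes the corner an end point of the edge of `j`.
  · have h1 : T.corner i k ∈ T.edge i (k - 1) := by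
      have := Q.end_mem_edgeAt (T.place i) (k - 1)
      rwa [sub_add_cancel] at this
    have h2 : T.corner i k ∈ T.edge j l := h ▸ Q.start_mem_edgeAt (T.place i) k
    rcases T.edge_eq_or i j (k - 1) l h1 h2 with h' | h'
    · have := T.edge_injective i (h'.trans h.symm)
      simp at this
    · exact h'.2
  · have h1 : T.corner i (k + 1) ∈ T.edge i (k + 1) := Q.start_mem_edgeAt (T.place i) (k + 1)
    have h2 : T.corner i (k + 1) ∈ T.edge j l := h ▸ Q.end_mem_edgeAt (T.place i) k
    rcases T.edge_eq_or i j (k + 1) l h1 h2 with h' | h'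
    · have := T.edge_injective i (h'.trans h.symm)
      simp at this
    · exact h'.2

theorem corners_of_edge_eq {i j : Fin f} {k l : Fin 4} (h : T.edge i k = T.edge j l) :
    (T.corner i k = T.corner j l ∧ T.corner i (k + 1) = T.corner j (l + 1)) ∨
      (T.corner i k = T.corner j (l + 1) ∧ T.corner i (k + 1) = T.corner j l) := by
  have hne : T.corner i k ≠ T.corner i (k + 1) := (T.corner_injective i).ne (by simp)
  obtain ⟨h1 | h1, h2 | h2⟩ := T.corner_mem_of_edge_eq h
  · exact absurd (h1.trans h2.symm) hne
  · exact Or.inl ⟨h1, h2⟩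
  · exact Or.inr ⟨h1, h2⟩
  · exact absurd (h1.trans h2.symm) hne

/-- If the common end points occur in opposite order, one arc is reversed so that both start at the
same point. -/
theorem len_eq_of_edge_eq {i j : Fin f} {k l : Fin 4} (h : T.edge i k = T.edge j l) :
    Q.len k = Q.len l := by
  have hn : ∀ (i : Fin f) (k : Fin 4), ‖(T.corner i k : E3)‖ = 1 := fun i k =>
    norm_eq_of_mem_sphere _
  have hd : ∀ (i : Fin f) (k : Fin 4), ‖T.place i (Q.dir k)‖ = 1 := fun i k => by
    rw [LinearIsometryEquiv.norm_map, Q.norm_dir]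
  have ho : ∀ (i : Fin f) (k : Fin 4), inner ℝ (T.corner i k : E3) (T.place i (Q.dir k)) = 0 :=
    fun i k => ((T.place i).inner_map_map _ _).trans (Q.dir_tangent k)
  have hL : ∀ k, Q.len k ∈ Ioo 0 (2 * π) := fun k => ⟨Q.len_pos k, Q.len_lt k⟩
  have hend : greatArc (T.corner j l) (T.place j (Q.dir l)) (Q.len l) = T.corner j (l + 1) := by
    have := congrArg (T.place j) (Q.closed l)
    rwa [map_greatArc] at this
  have hi : T.edge i k = arc (T.corner i k) (T.place i (Q.dir k)) (Q.len k) :=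
    Q.edgeAt_eq_arc _ k
  have hj : T.edge j l = arc (T.corner j l) (T.place j (Q.dir l)) (Q.len l) :=
    Q.edgeAt_eq_arc _ l
  rcases T.corners_of_edge_eq h with ⟨h1, -⟩ | ⟨h1, -⟩
  · rw [hi, hj, ← h1] at h
    exact arc_length_eq_of_start_eq (hn i k) (hd i k) (ho i k) (hd j l) (h1 ▸ ho j l) (hL k)
      (hL l) h
  · rw [hi, hj, ← arc_reverse (T.corner j l : E3), hend, ← h1] at h
    exact arc_length_eq_of_start_eq (hn i k) (hd i k) (ho i k)
      (norm_reverse (hn j l) (hd j l) (ho j l) _)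
      (by rw [h1, ← hend]; exact inner_reverse (hn j l) (hd j l) (ho j l) _) (hL k) (hL l) h

end SphereTiling

/-! ### Inward normals: at most two tiles share an edge. -/

namespace SphereTiling

variable {Q : SphericalQuadrilateral} {f : ℕ} (T : SphereTiling Q f)

/-- The unit normal of the edge `k` of the tile `i` that points into the tile. -/
noncomputable def inwardNormal (i : Fin f) (k : Fin 4) : E3 := T.place i (Q.leftNormal k)

theorem norm_inwardNormal (i : Fin f) (k : Fin 4) : ‖T.inwardNormal i k‖ = 1 := by
  rw [inwardNormal, LinearIsometryEquiv.norm_map, Q.norm_leftNormal]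

theorem inner_inwardNormal_of_mem_edge {i : Fin f} {k : Fin 4} {x : S2} (hx : x ∈ T.edge i k) :
    inner ℝ (x : E3) (T.inwardNormal i k) = 0 := by
  obtain ⟨y, ⟨t, -, hy⟩, rfl⟩ := hx
  rw [coe_sphereMap, inwardNormal, LinearIsometryEquiv.inner_map_map, hy, greatArc, inner_add_left,
    inner_smul_left, inner_smul_left]
  have h1 : inner ℝ (Q.vertex k : E3) (Q.leftNormal k) = 0 := inner_cross_left _ _
  have h2 : inner ℝ (Q.dir k) (Q.leftNormal k) = 0 := inner_cross_right _ _
  simp [h1, h2]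

theorem inwardNormal_eq_or_eq_neg {i j : Fin f} {k l : Fin 4} (h : T.edge i k = T.edge j l) :
    T.inwardNormal j l = T.inwardNormal i k ∨ T.inwardNormal j l = -T.inwardNormal i k := by
  -- With 0 < t < π, the start of the edge and its point at `t` are linearly independent, so they
  -- determine the plane of the edge; the end point could be antipodal to the start.
  set t := min (Q.len k) (π / 2) with ht
  have ht0 : 0 < t := lt_min (Q.len_pos k) (by positivity)
  have htπ : t < π := (min_le_right _ _).trans_lt (by linarith [pi_pos])
  have hsin : sin t ≠ 0 := (sin_pos_of_pos_of_lt_pi ht0 htπ).ne'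
  have hd : ∀ (i : Fin f) (k : Fin 4), ‖T.place i (Q.dir k)‖ = 1 := fun i k => by
    rw [LinearIsometryEquiv.norm_map, Q.norm_dir]
  have hn : ∀ (i : Fin f) (k : Fin 4), ‖(T.corner i k : E3)‖ = 1 := fun i k =>
    norm_eq_of_mem_sphere _
  have ho : inner ℝ (T.corner i k : E3) (T.place i (Q.dir k)) = 0 :=
    ((T.place i).inner_map_map _ _).trans (Q.dir_tangent k)
  have hstart : T.corner i k ∈ T.edge i k := Q.start_mem_edgeAt _ k
  have hpt : (⟨greatArc (T.corner i k) (T.place i (Q.dir k)) t, by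
      simp [norm_greatArc (hn i k) (hd i k) ho]⟩ : S2) ∈ T.edge i k := by
    rw [edge, Q.edgeAt_eq_arc]
    exact ⟨t, ⟨ht0.le, min_le_left _ _⟩, rfl⟩
  have hu : ∀ n : E3, inner ℝ (T.corner i k : E3) n = 0 →
      inner ℝ (greatArc (T.corner i k) (T.place i (Q.dir k)) t) n = 0 →
      inner ℝ (T.place i (Q.dir k)) n = 0 := by
    intro n h1 h2
    rw [greatArc, inner_add_left, inner_smul_left, inner_smul_left, h1] at h2
    simpa [hsin] using h2
  have h1 := T.inner_inwardNormal_of_mem_edge hstart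
  have h2 := T.inner_inwardNormal_of_mem_edge hpt
  have h3 := T.inner_inwardNormal_of_mem_edge (h ▸ hstart)
  have h4 := T.inner_inwardNormal_of_mem_edge (h ▸ hpt)
  exact eq_or_eq_neg_of_inner_eq_zero (hn i k) (hd i k) ho (T.norm_inwardNormal i k) h1
    (hu _ h1 h2) (T.norm_inwardNormal j l) h3 (hu _ h3 h4)

theorem eventually_inward_mem_tile {i : Fin f} {k : Fin 4} {x : S2} (hx : x ∈ T.edge i k)
    (h0 : x ≠ T.corner i k) (h1 : x ≠ T.corner i (k + 1)) :
    ∀ᶠ ε in 𝓝[>] (0 : ℝ), greatArc x (T.inwardNormal i k) ε ∈ ((↑) '' T.tile i : Set E3) := by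
  obtain ⟨y, ⟨t, ht, hy⟩, rfl⟩ := hx
  have ht0 : 0 < t := by
    refine ht.1.lt_of_ne ?_
    rintro rfl
    rw [greatArc_zero] at hy
    exact h0 (congrArg _ (Subtype.ext hy))
  have ht1 : t < Q.len k := by
    refine ht.2.lt_of_ne ?_
    rintro rfl
    rw [Q.closed k] at hy
    exact h1 (congrArg _ (Subtype.ext hy))
  filter_upwards [Q.region_left k t ⟨ht0, ht1⟩] with ε hε
  obtain ⟨z, hz, hz'⟩ := hε
  refine ⟨sphereMap (T.place i) z, mem_image_of_mem _ hz, ?_⟩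
  rw [coe_sphereMap, coe_sphereMap, hz', map_greatArc, hy]
  rfl

/-- With a common inward normal, a point slightly inward from the middle of the edge would lie in
both tiles, hence on the frontier of one of them; but it is off the great circle of the edge and
away from the other edges. -/
theorem inwardNormal_ne_of_edge_eq {i j : Fin f} (hij : i ≠ j) {k l : Fin 4}
    (h : T.edge i k = T.edge j l) : T.inwardNormal i k ≠ T.inwardNormal j l := by
  intro hN
  obtain ⟨y, t, ht, hy⟩ := Q.exists_interior_point k
  have hyk : y ∈ Q.edge k := ⟨t, ⟨ht.1.le, ht.2.le⟩, hy⟩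
  set x := sphereMap (T.place i) y with hxdef
  have hx : x ∈ T.edge i k := mem_image_of_mem _ hyk
  have hx0 : x ≠ T.corner i k := by
    intro h
    rw [sphereMap_injective _ h] at hy
    exact ht.1.ne' (Q.eq_of_interior ht ⟨le_rfl, (Q.len_pos k).le⟩
      (hy.symm.trans (greatArc_zero _ _).symm)).2
  have hx1 : x ≠ T.corner i (k + 1) := by
    intro h
    rw [sphereMap_injective _ h, ← Q.closed k] at hy
    exact ht.2.ne (Q.eq_of_interior ht ⟨(Q.len_pos k).le, le_rfl⟩ hy.symm).2
  have hxj : x ∈ T.edge j l := h ▸ hx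
  have hcor := T.corners_of_edge_eq h
  have hi := T.eventually_inward_mem_tile hx hx0 hx1
  have hj := T.eventually_inward_mem_tile hxj
    (by rcases hcor with h | h <;> [rw [← h.1]; rw [← h.2]] <;> assumption)
    (by rcases hcor with h | h <;> [rw [← h.2]; rw [← h.1]] <;> assumption)
  have hxN := T.inner_inwardNormal_of_mem_edge hx
  have hxn : ‖(x : E3)‖ = 1 := norm_eq_of_mem_sphere x
  set z : ℝ → S2 := fun ε => ⟨greatArc x (T.inwardNormal i k) ε, by
    simp [norm_greatArc hxn (T.norm_inwardNormal i k) hxN]⟩ with hz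
  have hzc : Continuous z := (continuous_greatArc _ _).subtype_mk _
  have hz0 : z 0 = x := Subtype.ext (greatArc_zero _ _)
  have hfar : ∀ᶠ ε in 𝓝[>] (0 : ℝ), ∀ k', k' ≠ k → z ε ∉ T.edge i k' := by
    rw [eventually_all]
    intro k'
    by_cases hk : k' = k
    · simp [hk]
    · have hcl : IsClosed (T.edge i k') := by
        rw [edge, Q.edgeAt_eq_arc]
        exact isClosed_arc _ _ _
      have hnot : z 0 ∉ T.edge i k' := by
        rw [hz0]
        intro hk'
        have := (sphereMap_injective _).mem_set_image.mp hk'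
        obtain ⟨s, hs, hs'⟩ := this
        exact hk (Q.eq_of_interior ht hs (hy.symm.trans hs')).1.symm
      have := hzc.continuousAt.eventually (hcl.isOpen_compl.mem_nhds hnot)
      filter_upwards [nhdsWithin_le_nhds this] with ε hε _ using hε
  have hpos : ∀ᶠ ε in 𝓝[>] (0 : ℝ), ε ∈ Ioo 0 π := Ioo_mem_nhdsGT pi_pos
  obtain ⟨ε, hε, hεi, hεj, hεfar⟩ := (hpos.and (hi.and (hj.and hfar))).exists
  rw [← hN] at hεj
  have hmem : ∀ m, greatArc x (T.inwardNormal i k) ε ∈ ((↑) '' T.tile m : Set E3) →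
      z ε ∈ T.tile m := by
    rintro m ⟨w, hw, hw'⟩
    rwa [← Subtype.ext (a1 := w) (a2 := z ε) hw']
  have hfr := T.mem_frontier_of_mem hij.symm (hmem j hεj) (hmem i hεi)
  rw [frontier_tile] at hfr
  obtain ⟨k', hk'⟩ := mem_iUnion.mp hfr
  by_cases hkk : k' = k
  · rw [hkk] at hk'
    have h1 := T.inner_inwardNormal_of_mem_edge hk'
    rw [real_inner_comm] at h1
    have h2 := inner_greatArc_right (T.norm_inwardNormal i k) hxN ε
    exact (sin_pos_of_pos_of_lt_pi hε.1 hε.2).ne' (h2.symm.trans h1)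
  · exact hεfar k' hkk hk'

/-- No edge is shared by three tiles. -/
theorem eq_of_edge_eq_of_edge_eq {i j m : Fin f} {k l n : Fin 4} (hj : T.edge i k = T.edge j l)
    (hm : T.edge i k = T.edge m n) (hij : i ≠ j) (him : i ≠ m) : j = m := by
  by_contra hjm
  have h1 := T.inwardNormal_ne_of_edge_eq hij hj
  have h2 := T.inwardNormal_ne_of_edge_eq him hm
  have h3 := T.inwardNormal_ne_of_edge_eq hjm (hj.symm.trans hm)
  rcases T.inwardNormal_eq_or_eq_neg hj with h4 | h4
  · exact h1 h4.symm
  rcases T.inwardNormal_eq_or_eq_neg hm with h5 | h5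
  · exact h2 h5.symm
  exact h3 (h4.trans h5.symm)

end SphereTiling

/-! ### The angle sum at a vertex, by integrating over directions. -/

theorem continuous_polarPoint_right (F : OrthonormalBasis (Fin 3) ℝ E3) (s : ℝ) :
    Continuous (polarPoint F s) :=
  (continuous_greatArc _ _).subtype_mk _

/-- Two frames at the same point differ by a rotation or a reflection. -/
theorem exists_polarPoint_frame_change {F F' : OrthonormalBasis (Fin 3) ℝ E3} (h : F 0 = F' 0) :
    ∃ θ σ : ℝ, (σ = 1 ∨ σ = -1) ∧ ∀ s ε, polarPoint F s ε = polarPoint F' (θ + σ * s) ε := by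
  have hF : ∀ i, i ≠ 0 → inner ℝ (F' 0) (F i) = 0 := fun i hi => by
    rw [← h, F.orthonormal.inner_eq_zero hi.symm]
  have e1 := eq_combination F' (F 1)
  have e2 := eq_combination F' (F 2)
  rw [hF 1 (by decide), zero_smul, zero_add] at e1
  rw [hF 2 (by decide), zero_smul, zero_add] at e2
  set a := inner ℝ (F' 1) (F 1)
  set b := inner ℝ (F' 2) (F 1)
  set c := inner ℝ (F' 1) (F 2)
  set d := inner ℝ (F' 2) (F 2)
  have hin : ∀ x y z w : ℝ, inner ℝ (x • F' 1 + y • F' 2) (z • F' 1 + w • F' 2) =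
      x * z + y * w := by
    intro x y z w
    simp only [inner_add_left, inner_add_right, inner_smul_left, inner_smul_right,
      F'.inner_eq_ite]
    simp
    ring
  have h11 : a * a + b * b = 1 := by
    rw [← hin, ← e1, F.inner_eq_ite]; simp
  have h22 : c * c + d * d = 1 := by
    rw [← hin, ← e2, F.inner_eq_ite]; simp
  have h12 : a * c + b * d = 0 := by
    rw [← hin, ← e1, ← e2, F.inner_eq_ite]; simp
  have hz : ‖(⟨a, b⟩ : ℂ)‖ = 1 := by
    rw [Complex.norm_def, Complex.normSq_apply, h11, sqrt_one]
  have ha := Complex.norm_mul_cos_arg ⟨a, b⟩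
  have hb := Complex.norm_mul_sin_arg ⟨a, b⟩
  rw [hz, one_mul] at ha hb
  set θ := Complex.arg ⟨a, b⟩
  -- The determinant of the change of frame is the sign σ: 1 for a rotation, −1 for a reflection.
  have hdet : (a * d - b * c) ^ 2 = 1 := by
    linear_combination h11 * (c * c + d * d) + h22 - (a * c + b * d) * h12
  have hc : c = -(a * d - b * c) * b := by linear_combination a * h12 - c * h11
  have hd : d = (a * d - b * c) * a := by linear_combination b * h12 - d * h11
  have hσ : a * d - b * c = 1 ∨ a * d - b * c = -1 := by
    rwa [← sq_eq_sq_iff_eq_or_eq_neg, one_pow]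
  refine ⟨θ, a * d - b * c, hσ, fun s ε => ?_⟩
  generalize a * d - b * c = σ at hσ hc hd
  have hcos : cos (θ + σ * s) = a * cos s - b * σ * sin s := by
    rcases hσ with rfl | rfl <;> simp [cos_add, ha, hb]
  have hsin : sin (θ + σ * s) = b * cos s + a * σ * sin s := by
    rcases hσ with rfl | rfl <;> simp [sin_add, ha, hb]
  apply Subtype.ext
  rw [coe_polarPoint, coe_polarPoint, hcos, hsin, ← h, e1, e2, hc, hd]
  module

/-- The indicator function of the directions that lie, up to multiples of `2π`, between `0` and
`α`. -/
noncomputable def sectorIndicator (α s : ℝ) : ℝ :=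
  if Int.fract (s / (2 * π)) * (2 * π) < α then 1 else 0

theorem periodic_sectorIndicator (α : ℝ) : Function.Periodic (sectorIndicator α) (2 * π) := by
  intro s
  rw [sectorIndicator, add_div, div_self two_pi_pos.ne', Int.fract_add_one, sectorIndicator]

theorem measurable_sectorIndicator (α : ℝ) : Measurable (sectorIndicator α) := by
  apply Measurable.ite _ measurable_const measurable_const
  exact measurableSet_lt
    ((measurable_fract.comp (measurable_id.div_const _)).mul_const _) measurable_const

theorem intervalIntegrable_sectorIndicator (α a b : ℝ) :
    IntervalIntegrable (sectorIndicator α) MeasureTheory.volume a b := by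
  rw [intervalIntegrable_iff]
  apply MeasureTheory.Measure.integrableOn_of_bounded (M := 1) (by simp)
    (measurable_sectorIndicator α).aestronglyMeasurable
  apply Eventually.of_forall
  intro s
  rw [sectorIndicator]
  split_ifs <;> simp

theorem fract_div_mul {s : ℝ} (hs : s ∈ Ico 0 (2 * π)) :
    Int.fract (s / (2 * π)) * (2 * π) = s := by
  rw [Int.fract_eq_self.mpr ⟨div_nonneg hs.1 two_pi_pos.le, (div_lt_one two_pi_pos).mpr hs.2⟩,
    div_mul_cancel₀ _ two_pi_pos.ne']

theorem integral_sectorIndicator {α : ℝ} (hα : α ∈ Ioo 0 (2 * π)) :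
    ∫ s in 0..(2 * π), sectorIndicator α s = α := by
  rw [← intervalIntegral.integral_add_adjacent_intervals
    (intervalIntegrable_sectorIndicator α 0 α) (intervalIntegrable_sectorIndicator α α (2 * π)),
    intervalIntegral.integral_congr_Ioo_of_le (g := fun _ => 1) hα.1.le,
    intervalIntegral.integral_congr_Ioo_of_le (g := fun _ => 0) hα.2.le]
  · simp
  · intro s hs
    simp only [sectorIndicator]
    rw [fract_div_mul ⟨(hα.1.trans hs.1).le, hs.2⟩, if_neg hs.1.not_gt]
  · intro s hs
    simp only [sectorIndicator]
    rw [fract_div_mul ⟨hs.1.le, hs.2.trans hα.2⟩, if_pos hs.2]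

theorem integral_sectorIndicator_comp {α θ σ : ℝ} (hα : α ∈ Ioo 0 (2 * π))
    (hσ : σ = 1 ∨ σ = -1) : ∫ t in 0..(2 * π), sectorIndicator α (θ + σ * t) = α := by
  have hper := (periodic_sectorIndicator α).intervalIntegral_add_eq
  refine Eq.trans ?_ (integral_sectorIndicator hα)
  rcases hσ with rfl | rfl
  · simp only [one_mul]
    rw [intervalIntegral.integral_comp_add_left, add_zero, hper θ 0, zero_add]
  · simp only [neg_one_mul, ← sub_eq_add_neg]
    rw [intervalIntegral.integral_comp_sub_left, sub_zero]
    have := hper (θ - 2 * π) 0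
    rwa [sub_add_cancel, zero_add] at this

theorem intervalIntegrable_sectorIndicator_comp (α θ σ : ℝ)
    (a b : ℝ) : IntervalIntegrable (fun t => sectorIndicator α (θ + σ * t))
      MeasureTheory.volume a b := by
  rw [intervalIntegrable_iff]
  apply MeasureTheory.Measure.integrableOn_of_bounded (M := 1) (by simp)
    ((measurable_sectorIndicator α).comp (by fun_prop)).aestronglyMeasurable
  apply Eventually.of_forall
  intro s
  simp only [Function.comp, sectorIndicator]
  split_ifs <;> simp

/-- All but countably many directions `t` avoid the boundary directions of a sector. -/
theorem ae_fract_notMem (α θ : ℝ) {σ : ℝ} (hσ : σ = 1 ∨ σ = -1) :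
    ∀ᵐ t : ℝ, Int.fract ((θ + σ * t) / (2 * π)) * (2 * π) ≠ 0 ∧
      Int.fract ((θ + σ * t) / (2 * π)) * (2 * π) ≠ α := by
  have hσ0 : σ ≠ 0 := by rcases hσ with rfl | rfl <;> norm_num
  have hone : ∀ β : ℝ, ∀ᵐ t : ℝ, Int.fract ((θ + σ * t) / (2 * π)) * (2 * π) ≠ β := by
    intro β
    have hc : (range fun m : ℤ => (m * (2 * π) + β - θ) / σ).Countable := countable_range _
    filter_upwards [hc.ae_notMem MeasureTheory.volume] with t ht h
    refine ht ⟨⌊(θ + σ * t) / (2 * π)⌋, ?_⟩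
    rw [Int.fract, sub_mul, div_mul_cancel₀ _ two_pi_pos.ne'] at h
    rw [div_eq_iff hσ0]
    linarith
  filter_upwards [hone 0, hone α] with t h1 h2 using ⟨h1, h2⟩

namespace SphereTiling

variable {Q : SphericalQuadrilateral} {f : ℕ} (T : SphereTiling Q f)

/-- The point lies on some edge of tile `j`. The two edges of tile `i` at it are different, so at
least one does not coincide with that edge, and edge-to-edge applies. -/
theorem exists_corner_eq_of_mem_tile {i j : Fin f} {k : Fin 4} (h : T.corner i k ∈ T.tile j) :
    ∃ l, T.corner j l = T.corner i k := by
  by_cases hij : i = j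
  · subst hij
    exact ⟨k, rfl⟩
  have hfr := T.mem_frontier_of_mem hij (T.corner_mem_tile i k) h
  rw [frontier_tile] at hfr
  obtain ⟨l, hl⟩ := mem_iUnion.mp hfr
  have h1 : T.corner i k ∈ T.edge i k := Q.start_mem_edgeAt _ k
  have h2 : T.corner i k ∈ T.edge i (k - 1) := by
    have := Q.end_mem_edgeAt (T.place i) (k - 1)
    rwa [sub_add_cancel] at this
  have key : T.corner i k = T.corner j l ∨ T.corner i k = T.corner j (l + 1) := by
    rcases T.edge_eq_or i j k l h1 hl with h3 | h3
    · rcases T.edge_eq_or i j (k - 1) l h2 hl with h4 | h4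
      · have := T.edge_injective i (h3.trans h4.symm)
        simp [eq_sub_iff_add_eq] at this
      · exact h4.2
    · exact h3.2
  rcases key with h | h
  · exact ⟨l, h.symm⟩
  · exact ⟨l + 1, h.symm⟩

/-- The angles at a vertex of the tiling sum to `2π`. -/
theorem sum_angle_eq (i₀ : Fin f) (k₀ : Fin 4) :
    ∑ k, (T.vertexType (T.corner i₀ k₀) k : ℝ) * Q.angle k = 2 * π := by
  classical
  set v := T.corner i₀ k₀ with hv
  set I : Finset (Fin f × Fin 4) := Finset.univ.filter fun x => T.corner x.1 x.2 = v with hI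
  have hsum : ∑ k, (T.vertexType v k : ℝ) * Q.angle k = ∑ x ∈ I, Q.angle x.2 := by
    rw [hI, Finset.sum_filter, Fintype.sum_prod_type_right]
    refine Finset.sum_congr rfl fun k _ => ?_
    rw [← Finset.sum_filter (fun i => T.corner i k = v)]
    dsimp only
    rw [Finset.sum_const, nsmul_eq_mul, vertexType,
      Nat.card_eq_fintype_card, Fintype.card_subtype]
  obtain ⟨F, hF, -⟩ := Q.sector_at_cornerAt (T.place i₀) k₀
  -- Every corner at `v` becomes a rotated or reflected sector in the one frame `F`; the boundary
  -- directions of the sectors are excluded. Corners elsewhere receive arbitrary values.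
  have hsec : ∀ x : Fin f × Fin 4, ∃ θ σ ε₀ : ℝ, (σ = 1 ∨ σ = -1) ∧ (T.corner x.1 x.2 = v →
      0 < ε₀ ∧ ∀ t, Int.fract ((θ + σ * t) / (2 * π)) * (2 * π) ≠ 0 →
        Int.fract ((θ + σ * t) / (2 * π)) * (2 * π) ≠ Q.angle x.2 → ∀ ε ∈ Ioo 0 ε₀,
        (sectorIndicator (Q.angle x.2) (θ + σ * t) = 1 ∧
          polarPoint F t ε ∈ interior (T.tile x.1)) ∨
        (sectorIndicator (Q.angle x.2) (θ + σ * t) = 0 ∧ polarPoint F t ε ∉ T.tile x.1)) := by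
    rintro ⟨i, k⟩
    by_cases hx : T.corner i k = v
    swap
    · exact ⟨0, 1, 0, Or.inl rfl, fun h => absurd h hx⟩
    obtain ⟨F', hF', ε₀, hε₀, hin, hout⟩ := Q.sector_at_cornerAt (T.place i) k
    have hFF' : F 0 = F' 0 := by
      rw [hF, hF']
      exact congrArg Subtype.val hx.symm
    obtain ⟨θ, σ, hσ, hθ⟩ := exists_polarPoint_frame_change hFF'
    refine ⟨θ, σ, ε₀, hσ, fun _ => ⟨hε₀, fun t h0 h1 ε hε => ?_⟩⟩
    have hpos : 0 < Int.fract ((θ + σ * t) / (2 * π)) * (2 * π) :=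
      lt_of_le_of_ne (mul_nonneg (Int.fract_nonneg _) two_pi_pos.le) h0.symm
    have hlt : Int.fract ((θ + σ * t) / (2 * π)) * (2 * π) < 2 * π := by
      have := Int.fract_lt_one ((θ + σ * t) / (2 * π))
      nlinarith [two_pi_pos]
    have hpt : polarPoint F t ε =
        polarPoint F' (Int.fract ((θ + σ * t) / (2 * π)) * (2 * π)) ε := by
      rw [hθ, ← polarPoint_add_int_mul_two_pi F' (Int.fract _ * _) ε ⌊(θ + σ * t) / (2 * π)⌋,
        ← add_mul, Int.fract_add_floor, div_mul_cancel₀ _ two_pi_pos.ne']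
    rcases lt_or_gt_of_ne h1 with h | h
    · left
      exact ⟨by rw [sectorIndicator, if_pos h], by rw [hpt]; exact hin _ ⟨hpos, h⟩ ε hε⟩
    · right
      exact ⟨by rw [sectorIndicator, if_neg h.not_gt], by rw [hpt]; exact hout _ ⟨h, hlt⟩ ε hε⟩
  choose θ σ ε₀ hσ hsec using hsec
  -- In almost every direction, a point close to `v` lies in some tile, which must have a corner at
  -- `v`, and by disjointness of interiors it lies in no other sector. Integrating this identity
  -- over a full turn gives the angle sum.
  have hae : ∀ᵐ t : ℝ, ∑ x ∈ I, sectorIndicator (Q.angle x.2) (θ x + σ x * t) = 1 := by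
    have hgood := MeasureTheory.ae_all_iff.mpr fun x : Fin f × Fin 4 => ae_fract_notMem (Q.angle x.2) (θ x) (hσ x)
    filter_upwards [hgood] with t ht
    have h1 : ∀ᶠ ε in 𝓝[>] (0 : ℝ), ∀ x ∈ I, ε ∈ Ioo 0 (ε₀ x) := by
      rw [Finset.eventually_all]
      intro x hx
      exact Ioo_mem_nhdsGT (hsec x (Finset.mem_filter.mp hx).2).1
    have h2 : ∀ᶠ ε in 𝓝[>] (0 : ℝ), ∀ m, v ∉ T.tile m → polarPoint F t ε ∉ T.tile m := by
      rw [eventually_all]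
      intro m
      by_cases hm : v ∈ T.tile m
      · simp [hm]
      have h0 : polarPoint F t 0 = v :=
        Subtype.ext ((polarPoint_zero_right F t).trans hF)
      have := (continuous_polarPoint_right F t).continuousAt.eventually
        ((T.isClosed_tile m).isOpen_compl.mem_nhds (by rw [h0]; exact hm))
      filter_upwards [nhdsWithin_le_nhds this] with ε hε _ using hε
    obtain ⟨ε, hε1, hε2⟩ := (h1.and h2).exists
    obtain ⟨m, hm⟩ := T.exists_mem_tile (polarPoint F t ε)
    have hvm : v ∈ T.tile m := by
      by_contra h
      exact hε2 m h hm
    obtain ⟨l, hl⟩ := T.exists_corner_eq_of_mem_tile hvm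
    have hmem : ((m, l) : Fin f × Fin 4) ∈ I := Finset.mem_filter.mpr ⟨Finset.mem_univ _, hl⟩
    rw [Finset.sum_eq_single_of_mem _ hmem]
    · rcases (hsec (m, l) hl).2 t (ht _).1 (ht _).2 ε (hε1 _ hmem) with h | h
      · exact h.1
      · exact absurd hm h.2
    · rintro ⟨j, n⟩ hx hne
      have hjn : T.corner j n = v := (Finset.mem_filter.mp hx).2
      rcases (hsec (j, n) hjn).2 t (ht _).1 (ht _).2 ε (hε1 _ hx) with h | h
      · exfalso
        by_cases hjm : m = j
        · subst hjm
          exact hne (Prod.ext rfl (T.corner_injective m (hjn.trans hl.symm)))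
        · exact T.notMem_interior_of_mem hjm hm h.2
      · exact h.1
  have hint : ∫ t in 0..(2 * π), ∑ x ∈ I, sectorIndicator (Q.angle x.2) (θ x + σ x * t) =
      2 * π := by
    rw [intervalIntegral.integral_congr_ae (g := fun _ => 1) (hae.mono fun t ht _ => ht)]
    simp
  rw [hsum, ← hint, intervalIntegral.integral_finsetSum]
  · exact Finset.sum_congr rfl fun x _ =>
      (integral_sectorIndicator_comp ⟨Q.angle_pos _, Q.angle_lt _⟩ (hσ x)).symm
  · exact fun x _ => intervalIntegrable_sectorIndicator_comp _ _ _ _ _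

end SphereTiling

/-! ### Connectedness of the tiling through edges, and distinctness of the poles. -/

/-- The complement of a finite subset of the sphere is connected. -/
theorem isPreconnected_compl_of_finite {V : Set S2} (hV : V.Finite) (hne : V.Nonempty) :
    IsPreconnected Vᶜ := by
  obtain ⟨v, hv⟩ := hne
  have : Fact (Module.finrank ℝ E3 = 2 + 1) := ⟨by simp⟩
  -- Projection from a point of `V` turns the complement into the plane minus a countable set.
  set e := stereographic' 2 v with he
  have hsource : e.source = {v}ᶜ := stereographic'_source v
  have htarget : e.target = univ := stereographic'_target v
  have hinj : InjOn e.symm univ := by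
    rw [← htarget]
    exact e.symm.injOn
  have hcount : (e.symm ⁻¹' V).Countable :=
    hV.countable.preimage_of_injOn (hinj.mono (subset_univ _))
  have hrank : 1 < Module.rank ℝ (EuclideanSpace ℝ (Fin 2)) := by
    rw [← Module.finrank_eq_rank]
    simp
  have hconn := (hcount.isConnected_compl_of_one_lt_rank hrank).isPreconnected
  have himage : e.symm '' (e.symm ⁻¹' V)ᶜ = Vᶜ := by
    ext y
    constructor
    · rintro ⟨x, hx, rfl⟩
      exact hx
    · intro hy
      have hys : y ∈ e.source := by
        rw [hsource]
        rintro rfl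
        exact hy hv
      refine ⟨e y, ?_, e.left_inv hys⟩
      rw [mem_compl_iff, mem_preimage, e.left_inv hys]
      exact hy
  rw [← himage]
  refine hconn.image _ (e.continuousOn_symm.mono ?_)
  rw [htarget]
  exact subset_univ _

namespace SphereTiling

variable {Q : SphericalQuadrilateral} {f : ℕ} (T : SphereTiling Q f)

theorem corner_notMem_interior_tile (i j : Fin f) (k : Fin 4) :
    T.corner i k ∉ interior (T.tile j) := by
  by_cases hij : i = j
  · subst hij
    have h : T.corner i k ∈ frontier (T.tile i) := by
      rw [frontier_tile]
      exact mem_iUnion.mpr ⟨k, Q.start_mem_edgeAt _ k⟩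
    exact h.2
  · exact T.notMem_interior_of_mem hij (T.corner_mem_tile i k)

theorem interior_tile_nonempty (i : Fin f) : (interior (T.tile i)).Nonempty := by
  rw [tile, Q.interior_tileAt]
  exact Q.isConnected_interior_region.nonempty.image _

/-- The tiles are connected through shared edges. -/
theorem forall_mem_of_edge_closed {K : Set (Fin f)} (hK : K.Nonempty)
    (hcl : ∀ i ∈ K, ∀ j k l, T.edge i k = T.edge j l → j ∈ K) : ∀ i, i ∈ K := by
  by_contra! hex
  obtain ⟨i₀, hi₀⟩ := hK
  obtain ⟨m, hm⟩ := hex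
  -- Away from the corners the sphere is still connected, so the closed unions of the tiles in `K`
  -- and of those outside `K` meet at a point that is not a corner; such a point lies on a shared
  -- edge.
  set V : Set S2 := range fun x : Fin f × Fin 4 => T.corner x.1 x.2 with hV
  have hpre : IsPreconnected Vᶜ :=
    isPreconnected_compl_of_finite (finite_range _) ⟨_, mem_range_self (i₀, 0)⟩
  have hint : ∀ i, ∀ x ∈ interior (T.tile i), x ∈ Vᶜ := by
    rintro i x hx ⟨⟨j, k⟩, rfl⟩
    exact T.corner_notMem_interior_tile j i k hx
  have hclosed : ∀ K : Set (Fin f), IsClosed (⋃ i ∈ K, T.tile i) := fun K =>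
    (toFinite K).isClosed_biUnion fun i _ => T.isClosed_tile i
  have hmeet : ∀ K : Set (Fin f), ∀ i ∈ K, (Vᶜ ∩ ⋃ i ∈ K, T.tile i).Nonempty := by
    intro K i hi
    obtain ⟨x, hx⟩ := T.interior_tile_nonempty i
    exact ⟨x, hint i x hx, mem_biUnion hi (interior_subset hx)⟩
  obtain ⟨x, hxV, hx, hx'⟩ := isPreconnected_closed_iff.mp hpre _ _ (hclosed K) (hclosed Kᶜ)
    (fun x _ => by
      obtain ⟨i, hi⟩ := T.exists_mem_tile x
      by_cases h : i ∈ K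
      · exact Or.inl (mem_biUnion h hi)
      · exact Or.inr (mem_biUnion h hi)) (hmeet K i₀ hi₀) (hmeet Kᶜ m hm)
  obtain ⟨i, hi, hxi⟩ := mem_iUnion₂.mp hx
  obtain ⟨j, hj, hxj⟩ := mem_iUnion₂.mp hx'
  have hij : i ≠ j := by
    rintro rfl
    exact hj hi
  have h1 := T.mem_frontier_of_mem hij.symm hxj hxi
  have h2 := T.mem_frontier_of_mem hij hxi hxj
  rw [frontier_tile] at h1 h2
  obtain ⟨k, hk⟩ := mem_iUnion.mp h1
  obtain ⟨l, hl⟩ := mem_iUnion.mp h2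
  rcases T.edge_eq_or i j k l hk hl with h | ⟨h | h, -⟩
  · exact hj (hcl i hi j k l h)
  · exact hxV ⟨(i, k), h.symm⟩
  · exact hxV ⟨(i, k + 1), h.symm⟩

/-- If a tiling by at least three tiles has no vertex at which two corners `B`, two corners `C` or
two corners `D` meet, then the corners `A` do not all lie at the same point. -/
theorem exists_corner_zero_ne (hU : ∀ i j k, k ≠ 0 → T.corner i k = T.corner j k → i = j)
    (hf : 3 ≤ f) (i₀ : Fin f) : ∃ i, T.corner i 0 ≠ T.corner i₀ 0 := by
  by_contra! hall
  -- If all corners A coincide, the antipode of that point is the image of one and the same point of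
  -- `Q` in every tile. Some tile contains it, hence all do, and it lies on the edge with the same
  -- index in each of them.
  have hneg : ∀ i, sphereMap (T.place i) (-Q.vertex 0) = -T.corner i₀ 0 := by
    intro i
    rw [← hall i]
    exact Subtype.ext ((T.place i).map_neg _)
  obtain ⟨m, hm⟩ := T.exists_mem_tile (-T.corner i₀ 0)
  rw [← hneg m] at hm
  have hreg := (sphereMap_injective _).mem_set_image.mp hm
  have htile : ∀ i, -T.corner i₀ 0 ∈ T.tile i := fun i => by
    rw [← hneg i]
    exact mem_image_of_mem _ hreg
  set i : Fin f := ⟨0, by omega⟩ with hi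
  set j : Fin f := ⟨1, by omega⟩ with hj
  set n : Fin f := ⟨2, by omega⟩ with hn
  have hij : i ≠ j := by simp [hi, hj]
  have hin : i ≠ n := by simp [hi, hn]
  have hjn : j ≠ n := by simp [hj, hn]
  have hfr := T.mem_frontier_of_mem hij (htile i) (htile j)
  rw [frontier_tile] at hfr
  obtain ⟨k, hk⟩ := mem_iUnion.mp hfr
  rw [← hneg j] at hk
  have hk := (sphereMap_injective _).mem_set_image.mp hk
  have hedge : ∀ i, -T.corner i₀ 0 ∈ T.edge i k := fun i => by
    rw [← hneg i]
    exact mem_image_of_mem _ hk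
  have hcorner : ∀ k, -T.corner i₀ 0 ≠ T.corner i k := by
    intro k h
    rw [← hneg i] at h
    have hv : -Q.vertex 0 = Q.vertex k := sphereMap_injective _ h
    by_cases hk0 : k = 0
    · rw [hk0] at hv
      exact ne_neg_of_mem_unit_sphere ℝ (Q.vertex 0) hv.symm
    · apply hij
      apply hU i j k hk0
      have h1 := hneg i
      have h2 := hneg j
      rw [hv] at h1 h2
      exact h1.trans h2.symm
  have hshare : ∀ j, T.edge i k = T.edge j k := by
    intro j
    rcases T.edge_eq_or i j k k (hedge i) (hedge j) with h | ⟨h | h, -⟩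
    · exact h
    · exact absurd h (hcorner _)
    · exact absurd h (hcorner _)
  exact hjn (T.eq_of_edge_eq_of_edge_eq (hshare j) (hshare n) hij hin)

end SphereTiling

/-! ### Counting angles at a vertex: angle sum and parity. -/

theorem eq_of_sum_mul_eq {ι : Type*} [Fintype ι] {m n : ι → ℕ} {a : ι → ℝ} (ha : ∀ k, 0 < a k)
    (hmn : m ≤ n) (h : ∑ k, (n k : ℝ) * a k = ∑ k, (m k : ℝ) * a k) : n = m := by
  have hterm : ∀ k ∈ Finset.univ, (m k : ℝ) * a k ≤ (n k : ℝ) * a k := fun k _ =>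
    mul_le_mul_of_nonneg_right (Nat.cast_le.mpr (hmn k)) (ha k).le
  have := (Finset.sum_eq_sum_iff_of_le hterm).mp h.symm
  funext k
  exact_mod_cast (mul_right_cancel₀ (ha k).ne' (this k (Finset.mem_univ k))).symm

namespace SphereTiling

variable {Q : SphericalQuadrilateral} {f : ℕ} (T : SphereTiling Q f)

theorem vertexType_pos {v : S2} {i : Fin f} {k : Fin 4} (h : T.corner i k = v) :
    1 ≤ T.vertexType v k := by
  have : Nonempty {i : Fin f // T.corner i k = v} := ⟨⟨i, h⟩⟩
  exact Nat.card_pos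

theorem eq_of_vertexType_eq_one {v : S2} {k : Fin 4} (hv : T.vertexType v k = 1) {i j : Fin f}
    (hi : T.corner i k = v) (hj : T.corner j k = v) : i = j := by
  have : Subsingleton {i : Fin f // T.corner i k = v} :=
    (Nat.card_eq_one_iff_unique.mp hv).1
  exact congrArg Subtype.val (Subsingleton.elim (⟨i, hi⟩ : {i : Fin f // T.corner i k = v}) ⟨j, hj⟩)

theorem exists_corner_of_vertexType_pos {v : S2} {k : Fin 4} (hv : 1 ≤ T.vertexType v k) :
    ∃ i, T.corner i k = v := by
  have : Nonempty {i : Fin f // T.corner i k = v} :=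
    (Nat.card_pos_iff.mp (show 0 < T.vertexType v k from hv)).1
  exact ⟨this.some.1, this.some.2⟩

/-- Coinciding edges have equal lengths, and among the four lengths only those of AB and DA agree.
-/
theorem edge_index (hQ : Q.IsA2BC) {i j : Fin f} {k l : Fin 4} (h : T.edge i k = T.edge j l) :
    k = l ∨ (k = 0 ∧ l = 3) ∨ (k = 3 ∧ l = 0) := by
  have hlen := T.len_eq_of_edge_eq h
  obtain ⟨h03, h01, h02, h12⟩ := hQ
  fin_cases k <;> fin_cases l <;> simp <;> simp at hlen <;> simp_all

theorem exists_partner (hQ : Q.IsA2BC) {k : Fin 4} (hk : k = 1 ∨ k = 2) (i : Fin f) :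
    ∃ j ≠ i, T.edge j k = T.edge i k := by
  obtain ⟨j, hj, l, h⟩ := T.exists_edge_eq i k
  refine ⟨j, hj, ?_⟩
  rcases T.edge_index hQ h with rfl | ⟨-, rfl⟩ | ⟨-, rfl⟩
  · exact h
  · rcases hk with hk | hk <;> simp at hk
  · rcases hk with hk | hk <;> simp at hk

/-- At every vertex, the ends of the edges of length `b`, and of length `c`, are paired. -/
theorem even_vertexType_add (hQ : Q.IsA2BC) {k : Fin 4} (hk : k = 1 ∨ k = 2) (v : S2) :
    Even (T.vertexType v k + T.vertexType v (k + 1)) := by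
  classical
  choose p hp hpe using T.exists_partner hQ hk
  have hpp : ∀ i, p (p i) = i := fun i =>
    T.eq_of_edge_eq_of_edge_eq (hpe (p i)).symm (hpe i) (hp (p i)).symm (hp i)
  set S₁ : Finset (Fin f) := Finset.univ.filter fun i => T.corner i k = v with hS₁
  set S₂ : Finset (Fin f) := Finset.univ.filter fun i => T.corner i (k + 1) = v with hS₂
  have hdisj : Disjoint S₁ S₂ := by
    rw [Finset.disjoint_left]
    intro i h1 h2
    have := T.corner_injective i
      ((Finset.mem_filter.mp h1).2.trans (Finset.mem_filter.mp h2).2.symm)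
    simp at this
  have hcard : T.vertexType v k + T.vertexType v (k + 1) = (S₁ ∪ S₂).card := by
    rw [Finset.card_union_of_disjoint hdisj, vertexType, vertexType, Nat.card_eq_fintype_card,
      Nat.card_eq_fintype_card, Fintype.card_subtype, Fintype.card_subtype]
  have hmem : ∀ i ∈ S₁ ∪ S₂, p i ∈ S₁ ∪ S₂ := by
    intro i hi
    simp only [hS₁, hS₂, Finset.mem_union, Finset.mem_filter, Finset.mem_univ, true_and] at hi ⊢
    rcases T.corners_of_edge_eq (hpe i) with ⟨h1, h2⟩ | ⟨h1, h2⟩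
    · rwa [h1, h2]
    · rw [h1, h2]
      exact hi.symm
  -- Passing to the partner is an involution without fixed points, so the number of tiles is even.
  have hsum : ∑ _i ∈ S₁ ∪ S₂, (1 : ZMod 2) = 0 :=
    Finset.sum_involution (fun i _ => p i) (fun _ _ => by decide) (fun i _ _ => hp i)
      hmem (fun i _ => hpp i)
  rw [hcard, ← ZMod.natCast_eq_zero_iff_even]
  simpa using hsum

end SphereTiling

/-! ### All corners B, C, D lie at vertices βγδ. -/

namespace SphereTiling

variable {Q : SphericalQuadrilateral} {f : ℕ} (T : SphereTiling Q f)

/-- Angles that already use up 2π leave no room for others, as all angles are positive. -/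
theorem vertexType_eq_of_le (i : Fin f) (k : Fin 4) {m : Fin 4 → ℕ}
    (hm : m ≤ T.vertexType (T.corner i k)) (hsum : 2 * π ≤ ∑ k, (m k : ℝ) * Q.angle k) :
    T.vertexType (T.corner i k) = m := by
  apply eq_of_sum_mul_eq Q.angle_pos hm
  apply le_antisymm
  · rwa [T.sum_angle_eq]
  · exact Finset.sum_le_sum fun k _ =>
      mul_le_mul_of_nonneg_right (Nat.cast_le.mpr (hm k)) (Q.angle_pos k).le

theorem vertexType_eq_of_pos (hτ : Q.angle 1 + Q.angle 2 + Q.angle 3 = 2 * π) (i : Fin f)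
    (k : Fin 4) (h1 : 1 ≤ T.vertexType (T.corner i k) 1) (h2 : 1 ≤ T.vertexType (T.corner i k) 2)
    (h3 : 1 ≤ T.vertexType (T.corner i k) 3) :
    T.vertexType (T.corner i k) = ![0, 1, 1, 1] := by
  apply T.vertexType_eq_of_le
  · intro l
    fin_cases l
    · exact Nat.zero_le _
    · exact h1
    · exact h2
    · exact h3
  · simp only [Fin.sum_univ_four]
    simp
    linarith

/-- Without δ, parity makes the number of γ even, then the number of β even, so both are at least 2;
but 2β + 2γ = 4π − 2δ > 2π. -/
theorem vertexType_eq_of_beta_gamma (hQ : Q.IsA2BC)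
    (hτ : Q.angle 1 + Q.angle 2 + Q.angle 3 = 2 * π) (hδ : Q.angle 3 < π) (i : Fin f) (k : Fin 4)
    (h1 : 1 ≤ T.vertexType (T.corner i k) 1) (h2 : 1 ≤ T.vertexType (T.corner i k) 2) :
    T.vertexType (T.corner i k) = ![0, 1, 1, 1] := by
  have e1 : Even (T.vertexType (T.corner i k) 1 + T.vertexType (T.corner i k) 2) :=
    T.even_vertexType_add hQ (Or.inl rfl) _
  have e2 : Even (T.vertexType (T.corner i k) 2 + T.vertexType (T.corner i k) 3) :=
    T.even_vertexType_add hQ (Or.inr rfl) _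
  by_cases h3 : 1 ≤ T.vertexType (T.corner i k) 3
  · exact T.vertexType_eq_of_pos hτ i k h1 h2 h3
  exfalso
  have h := T.vertexType_eq_of_le i k (m := ![0, 2, 2, 0]) (by
    intro l
    fin_cases l
    · exact Nat.zero_le _
    · change 2 ≤ T.vertexType (T.corner i k) 1
      grind
    · change 2 ≤ T.vertexType (T.corner i k) 2
      grind
    · exact Nat.zero_le _) (by
    simp only [Fin.sum_univ_four]
    simp
    linarith)
  have hs := T.sum_angle_eq i k
  rw [h, Fin.sum_univ_four] at hs
  simp at hs
  linarith

theorem vertexType_eq_of_gamma_delta (hQ : Q.IsA2BC)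
    (hτ : Q.angle 1 + Q.angle 2 + Q.angle 3 = 2 * π) (hβ : Q.angle 1 < π) (i : Fin f) (k : Fin 4)
    (h2 : 1 ≤ T.vertexType (T.corner i k) 2) (h3 : 1 ≤ T.vertexType (T.corner i k) 3) :
    T.vertexType (T.corner i k) = ![0, 1, 1, 1] := by
  have e1 : Even (T.vertexType (T.corner i k) 1 + T.vertexType (T.corner i k) 2) :=
    T.even_vertexType_add hQ (Or.inl rfl) _
  have e2 : Even (T.vertexType (T.corner i k) 2 + T.vertexType (T.corner i k) 3) :=
    T.even_vertexType_add hQ (Or.inr rfl) _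
  by_cases h1 : 1 ≤ T.vertexType (T.corner i k) 1
  · exact T.vertexType_eq_of_pos hτ i k h1 h2 h3
  exfalso
  have h := T.vertexType_eq_of_le i k (m := ![0, 0, 2, 2]) (by
    intro l
    fin_cases l
    · exact Nat.zero_le _
    · exact Nat.zero_le _
    · change 2 ≤ T.vertexType (T.corner i k) 2
      grind
    · change 2 ≤ T.vertexType (T.corner i k) 3
      grind) (by
    simp only [Fin.sum_univ_four]
    simp
    linarith)
  have hs := T.sum_angle_eq i k
  rw [h, Fin.sum_univ_four] at hs
  simp at hs
  linarith

/-- If one of the angles `β`, `γ`, `δ` is not less than `π`, then it occurs at vertices `βγδ`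
only, and by counting so do the other two. -/
theorem vertexType_eq_of_pi_le (hQ : Q.IsA2BC) (hτ : Q.angle 1 + Q.angle 2 + Q.angle 3 = 2 * π)
    {k₀ : Fin 4} (hk₀ : k₀ ≠ 0) (hπ : π ≤ Q.angle k₀) (j : Fin f) (k : Fin 4) (hk : k ≠ 0) :
    T.vertexType (T.corner j k) = ![0, 1, 1, 1] := by
  -- Two copies of an angle of at least π fill the vertex, whose degree would then be 2.
  have hone : ∀ i, T.vertexType (T.corner i k₀) k₀ = 1 := by
    intro i
    refine le_antisymm ?_ (T.vertexType_pos rfl)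
    by_contra! h2
    have h := T.vertexType_eq_of_le i k₀ (m := Pi.single k₀ 2) (by
      intro l
      by_cases hl : l = k₀
      · subst hl
        rw [Pi.single_eq_same]
        exact h2
      · simp [hl]) (by
      rw [Finset.sum_eq_single k₀ (fun l _ hl => by simp [hl]) (by simp)]
      simp
      linarith)
    have hdeg : 3 ≤ ∑ l, T.vertexType (T.corner i k₀) l := T.degree_ge i k₀
    rw [h] at hdeg
    simp at hdeg
  have hbase : ∀ i, T.vertexType (T.corner i k₀) = ![0, 1, 1, 1] := by
    intro i
    have h0 := hone i
    have e1 : Even (T.vertexType (T.corner i k₀) 1 + T.vertexType (T.corner i k₀) 2) :=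
      T.even_vertexType_add hQ (Or.inl rfl) _
    have e2 : Even (T.vertexType (T.corner i k₀) 2 + T.vertexType (T.corner i k₀) 3) :=
      T.even_vertexType_add hQ (Or.inr rfl) _
    have hk : k₀ = 1 ∨ k₀ = 2 ∨ k₀ = 3 := by
      fin_cases k₀ <;> simp at hk₀ ⊢
    have hpos : 1 ≤ T.vertexType (T.corner i k₀) 1 ∧ 1 ≤ T.vertexType (T.corner i k₀) 2 ∧
        1 ≤ T.vertexType (T.corner i k₀) 3 := by
      generalize T.vertexType (T.corner i k₀) = t at h0 e1 e2
      rw [Nat.even_iff] at e1 e2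
      rcases hk with rfl | rfl | rfl <;> omega
    exact T.vertexType_eq_of_pos hτ i k₀ hpos.1 hpos.2.1 hpos.2.2
  have hex : ∀ i, ∃ j, T.corner j k = T.corner i k₀ := by
    intro i
    apply T.exists_corner_of_vertexType_pos
    rw [hbase i]
    fin_cases k <;> simp at hk ⊢
  choose p hp using hex
  -- Sending a tile to the one whose corner `k` lies at its corner `k₀` is injective on a finite
  -- set, hence surjective: every corner `k` is reached.
  have hinj : Function.Injective p := by
    intro i i' h
    have h1 := hp i
    rw [h, hp i'] at h1
    exact T.eq_of_vertexType_eq_one (hone i) rfl h1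
  obtain ⟨i, rfl⟩ := Finite.injective_iff_surjective.mp hinj j
  rw [hp, hbase]

/-- The property spreads within a tile: the neighbour across BC or CD is glued in reverse, since
otherwise βγδ would contain the same corner twice. So B and C, or C and D, meet at the other end,
which is then βγδ too. -/
theorem vertexType_eq_of_lt_pi (hQ : Q.IsA2BC) (hτ : Q.angle 1 + Q.angle 2 + Q.angle 3 = 2 * π)
    (hβ : Q.angle 1 < π) (hδ : Q.angle 3 < π) {i₀ : Fin f}
    (hi₀ : T.vertexType (T.corner i₀ 2) = ![0, 1, 1, 1]) (j : Fin f) (k : Fin 4) (hk : k ≠ 0) :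
    T.vertexType (T.corner j k) = ![0, 1, 1, 1] := by
  have huniq : ∀ {i j : Fin f} {k : Fin 4}, k ≠ 0 →
      T.vertexType (T.corner i k) = ![0, 1, 1, 1] → T.corner j k = T.corner i k → j = i := by
    intro i j k hk h hji
    refine T.eq_of_vertexType_eq_one ?_ hji rfl
    rw [h]
    fin_cases k <;> simp at hk ⊢
  have hA : ∀ {i j : Fin f} {k : Fin 4}, T.vertexType (T.corner i k) = ![0, 1, 1, 1] →
      T.corner j 0 ≠ T.corner i k := by
    intro i j k h hji
    have := T.vertexType_pos hji
    rw [h] at this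
    simp at this
  have hB : ∀ {i : Fin f}, T.vertexType (T.corner i 2) = ![0, 1, 1, 1] →
      T.vertexType (T.corner i 1) = ![0, 1, 1, 1] := by
    intro i hi
    obtain ⟨j, hj, h⟩ := T.exists_partner hQ (Or.inl rfl) i
    rcases T.corners_of_edge_eq h with ⟨-, h2⟩ | ⟨h1, h2⟩
    · exact absurd (huniq (by decide) hi h2) hj
    · exact T.vertexType_eq_of_beta_gamma hQ hτ hδ i 1 (T.vertexType_pos rfl)
        (T.vertexType_pos h2)
  have hD : ∀ {i : Fin f}, T.vertexType (T.corner i 2) = ![0, 1, 1, 1] →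
      T.vertexType (T.corner i 3) = ![0, 1, 1, 1] := by
    intro i hi
    obtain ⟨j, hj, h⟩ := T.exists_partner hQ (Or.inr rfl) i
    rcases T.corners_of_edge_eq h with ⟨h1, -⟩ | ⟨h1, h2⟩
    · exact absurd (huniq (by decide) hi h1) hj
    · exact T.vertexType_eq_of_gamma_delta hQ hτ hβ i 3 (T.vertexType_pos h1)
        (T.vertexType_pos rfl)
  have hCB : ∀ {i : Fin f}, T.vertexType (T.corner i 1) = ![0, 1, 1, 1] →
      T.vertexType (T.corner i 2) = ![0, 1, 1, 1] := by
    intro i hi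
    obtain ⟨j, hj, h⟩ := T.exists_partner hQ (Or.inl rfl) i
    rcases T.corners_of_edge_eq h with ⟨h1, -⟩ | ⟨h1, h2⟩
    · exact absurd (huniq (by decide) hi h1) hj
    · exact T.vertexType_eq_of_beta_gamma hQ hτ hδ i 2 (T.vertexType_pos h1)
        (T.vertexType_pos rfl)
  have hCD : ∀ {i : Fin f}, T.vertexType (T.corner i 3) = ![0, 1, 1, 1] →
      T.vertexType (T.corner i 2) = ![0, 1, 1, 1] := by
    intro i hi
    obtain ⟨j, hj, h⟩ := T.exists_partner hQ (Or.inr rfl) i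
    rcases T.corners_of_edge_eq h with ⟨-, h2⟩ | ⟨h1, h2⟩
    · exact absurd (huniq (by decide) hi h2) hj
    · exact T.vertexType_eq_of_gamma_delta hQ hτ hβ i 2 (T.vertexType_pos rfl)
        (T.vertexType_pos h2)
  -- It spreads between tiles as well: a shared edge has an end that is not a corner A of tile `i`.
  -- This end is βγδ, so it is a corner B, C or D of the neighbour.
  have hall : ∀ i, i ∈ {i | T.vertexType (T.corner i 2) = ![0, 1, 1, 1]} := by
    apply T.forall_mem_of_edge_closed ⟨i₀, hi₀⟩
    intro i hi j k l h
    change T.vertexType (T.corner i 2) = _ at hi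
    change T.vertexType (T.corner j 2) = _
    have hends := T.corners_of_edge_eq h
    rcases T.edge_index hQ h with rfl | ⟨rfl, rfl⟩ | ⟨rfl, rfl⟩
    · fin_cases k
      · rcases hends with ⟨-, h2⟩ | ⟨-, h2⟩
        · exact hCB (h2 ▸ hB hi)
        · exact absurd h2.symm (hA (hB hi))
      · rcases hends with ⟨h1, -⟩ | ⟨h1, -⟩
        · exact hCB (h1 ▸ hB hi)
        · exact h1 ▸ hB hi
      · rcases hends with ⟨h1, -⟩ | ⟨-, h2⟩
        · exact h1 ▸ hi
        · exact h2 ▸ hD hi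
      · rcases hends with ⟨h1, -⟩ | ⟨h1, -⟩
        · exact hCD (h1 ▸ hD hi)
        · exact absurd h1.symm (hA (hD hi))
    · rcases hends with ⟨-, h2⟩ | ⟨-, h2⟩
      · exact absurd h2.symm (hA (hB hi))
      · exact hCD (h2 ▸ hB hi)
    · rcases hends with ⟨h1, -⟩ | ⟨h1, -⟩
      · exact absurd h1.symm (hA (hD hi))
      · exact hCB (h1 ▸ hD hi)
  fin_cases k
  · exact absurd rfl hk
  · exact hB (hall j)
  · exact hall j
  · exact hD (hall j)

/-- If `βγδ` is a vertex, then all corners `B`, `C`, `D` lie at vertices `βγδ`. -/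
theorem vertexType_eq_of_mem_AVC (hQ : Q.IsA2BC) (hmem : ![0, 1, 1, 1] ∈ T.AVC) (j : Fin f)
    (k : Fin 4) (hk : k ≠ 0) : T.vertexType (T.corner j k) = ![0, 1, 1, 1] := by
  obtain ⟨i, l, hil⟩ := hmem
  have hτ : Q.angle 1 + Q.angle 2 + Q.angle 3 = 2 * π := by
    have h := T.sum_angle_eq i l
    rw [← hil, Fin.sum_univ_four] at h
    simpa using h
  by_cases hβ : π ≤ Q.angle 1
  · exact T.vertexType_eq_of_pi_le hQ hτ (by decide) hβ j k hk
  by_cases hδ : π ≤ Q.angle 3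
  · exact T.vertexType_eq_of_pi_le hQ hτ (by decide) hδ j k hk
  obtain ⟨i₀, hi₀⟩ := T.exists_corner_of_vertexType_pos (v := T.corner i l) (k := 2)
    (by rw [← hil]; simp)
  exact T.vertexType_eq_of_lt_pi hQ hτ (not_le.mp hβ) (not_le.mp hδ)
    (hi₀ ▸ hil.symm) j k hk

end SphereTiling

/-! ### Neighbours across the edges, and the two rings of tiles. -/

namespace SphereTiling

variable {Q : SphericalQuadrilateral} {f : ℕ} (T : SphereTiling Q f)

/-- At most one corner `B`, one corner `C` and one corner `D` lie at each point, and no corner `A`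
lies at the same point as one of these. -/
structure IsSeparated : Prop where
  eq_of_corner_eq : ∀ {i j : Fin f} {k : Fin 4}, k ≠ 0 → T.corner i k = T.corner j k → i = j
  corner_zero_ne : ∀ (i j : Fin f) {k : Fin 4}, k ≠ 0 → T.corner i 0 ≠ T.corner j k

variable {T}

theorem isSeparated_of_vertexType
    (h : ∀ i k, k ≠ 0 → T.vertexType (T.corner i k) = ![0, 1, 1, 1]) : T.IsSeparated where
  eq_of_corner_eq {i j k} hk hij := by
    refine T.eq_of_vertexType_eq_one ?_ rfl hij.symm
    rw [h i k hk]
    fin_cases k <;> simp at hk ⊢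
  corner_zero_ne i j k hk hij := by
    have := T.vertexType_pos hij
    rw [h j k hk] at this
    simp at this

namespace IsSeparated

variable (hT : T.IsSeparated) (hQ : Q.IsA2BC)

include hT hQ

/-- The neighbour along the edge `AB`. -/
theorem exists_neighbour_zero (i : Fin f) : ∃ j, T.edge j 3 = T.edge i 0 ∧
    T.corner j 0 = T.corner i 0 ∧ T.corner j 3 = T.corner i 1 := by
  obtain ⟨j, hj, l, h⟩ := T.exists_edge_eq i 0
  have hends := T.corners_of_edge_eq h
  rcases T.edge_index hQ h with rfl | ⟨-, h'⟩ | ⟨rfl, -⟩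
  · rcases hends with ⟨-, h2⟩ | ⟨h1, -⟩
    · exact absurd (hT.eq_of_corner_eq (by decide) h2) hj
    · exact absurd h1 (hT.corner_zero_ne j i (by decide))
  · simp at h'
  · rcases hends with ⟨h1, -⟩ | ⟨h1, h2⟩
    · exact absurd h1.symm (hT.corner_zero_ne i j (by decide))
    · exact ⟨j, h, h2, h1⟩

theorem exists_neighbour_three (i : Fin f) : ∃ j, T.edge j 0 = T.edge i 3 ∧
    T.corner j 0 = T.corner i 0 ∧ T.corner j 1 = T.corner i 3 := by
  obtain ⟨j, hj, l, h⟩ := T.exists_edge_eq i 3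
  have hends := T.corners_of_edge_eq h
  rcases T.edge_index hQ h with rfl | ⟨rfl, -⟩ | ⟨-, h'⟩
  · rcases hends with ⟨h1, -⟩ | ⟨h1, h2⟩
    · exact absurd (hT.eq_of_corner_eq (by decide) h1) hj
    · exact absurd h2 (hT.corner_zero_ne j i (by decide))
  · rcases hends with ⟨h1, -⟩ | ⟨h1, h2⟩
    · exact absurd h1 (hT.corner_zero_ne j i (by decide))
    · exact ⟨j, h, h1, h2⟩
  · simp at h'

/-- Gluing without reversal would put two corners B at one point. -/
theorem exists_neighbour_one (i : Fin f) : ∃ j, T.edge j 1 = T.edge i 1 ∧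
    T.corner j 1 = T.corner i 2 ∧ T.corner j 2 = T.corner i 1 := by
  obtain ⟨j, hj, h⟩ := T.exists_partner hQ (Or.inl rfl) i
  refine ⟨j, h, ?_⟩
  rcases T.corners_of_edge_eq h with ⟨h1, -⟩ | h12
  · exact absurd (hT.eq_of_corner_eq (by decide) h1) hj
  · exact h12

theorem exists_neighbour_two (i : Fin f) : ∃ j, T.edge j 2 = T.edge i 2 ∧
    T.corner j 2 = T.corner i 3 ∧ T.corner j 3 = T.corner i 2 := by
  obtain ⟨j, hj, h⟩ := T.exists_partner hQ (Or.inr rfl) i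
  refine ⟨j, h, ?_⟩
  rcases T.corners_of_edge_eq h with ⟨h1, -⟩ | h12
  · exact absurd (hT.eq_of_corner_eq (by decide) h1) hj
  · exact h12

/-- Lets edges be compared through their end points alone, as the earth map does. A shared corner B,
C or D identifies the second tile with the first or with a known neighbour; all other coincidences
contradict separation. -/
theorem edge_eq_of_ends_eq_of_le {i j : Fin f} {k l : Fin 4} (hkl : k ≤ l)
    (h : (T.corner i k = T.corner j l ∧ T.corner i (k + 1) = T.corner j (l + 1)) ∨
      (T.corner i k = T.corner j (l + 1) ∧ T.corner i (k + 1) = T.corner j l)) :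
    T.edge i k = T.edge j l := by
  have hU : ∀ {i j : Fin f} {k : Fin 4}, k ≠ 0 → T.corner i k = T.corner j k → i = j :=
    fun hk h => hT.eq_of_corner_eq hk h
  have hZ : ∀ (i j : Fin f) {k : Fin 4}, k ≠ 0 → T.corner i 0 ≠ T.corner j k :=
    fun i j _ hk => hT.corner_zero_ne i j hk
  have hC : ∀ {i j : Fin f}, T.corner i 1 = T.corner j 2 → T.corner i 2 = T.corner j 3 → False := by
    intro i j h1 h2
    obtain ⟨m, -, h3, h4⟩ := hT.exists_neighbour_one hQ i
    obtain rfl := hU (by decide) (h4.trans h1)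
    have := T.corner_injective m (h3.trans h2)
    simp at this
  have hC' : ∀ {i j : Fin f}, T.corner i 1 = T.corner j 3 → T.corner i 2 = T.corner j 2 →
      False := by
    intro i j h1 h2
    obtain rfl := hU (by decide) h2
    have := T.corner_injective i h1
    simp at this
  fin_cases k <;> fin_cases l <;> simp at hkl <;> rcases h with ⟨h1, h2⟩ | ⟨h1, h2⟩
  · exact congrArg (T.edge · 0) (hU (k := 1) (by decide) h2)
  · exact absurd h1 (hZ i j (by decide))
  · exact absurd h1 (hZ i j (k := 1) (by decide))
  · exact absurd h1 (hZ i j (k := 2) (by decide))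
  · exact absurd h1 (hZ i j (k := 2) (by decide))
  · exact absurd h1 (hZ i j (k := 3) (by decide))
  · exact absurd h1 (hZ i j (k := 3) (by decide))
  · obtain ⟨m, hm, -, h3⟩ := hT.exists_neighbour_zero hQ i
    obtain rfl := hU (by decide) (h3.trans h2)
    exact hm.symm
  · exact congrArg (T.edge · 1) (hU (k := 1) (by decide) h1)
  · obtain ⟨m, hm, h3, -⟩ := hT.exists_neighbour_one hQ i
    obtain rfl := hU (by decide) (h3.trans h2)
    exact hm.symm
  · exact (hC h1 h2).elim
  · exact (hC' h1 h2).elim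
  · exact absurd h2.symm (hZ j i (k := 2) (by decide))
  · exact absurd h1.symm (hZ j i (k := 1) (by decide))
  · exact congrArg (T.edge · 2) (hU (k := 2) (by decide) h1)
  · obtain ⟨m, hm, h3, -⟩ := hT.exists_neighbour_two hQ i
    obtain rfl := hU (by decide) (h3.trans h2)
    exact hm.symm
  · exact absurd h2.symm (hZ j i (k := 3) (by decide))
  · exact absurd h1.symm (hZ j i (k := 2) (by decide))
  · exact congrArg (T.edge · 3) (hU (k := 3) (by decide) h1)
  · exact absurd h1.symm (hZ j i (k := 3) (by decide))

theorem edge_eq_iff {i j : Fin f} {k l : Fin 4} : T.edge i k = T.edge j l ↔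
    (T.corner i k = T.corner j l ∧ T.corner i (k + 1) = T.corner j (l + 1)) ∨
      (T.corner i k = T.corner j (l + 1) ∧ T.corner i (k + 1) = T.corner j l) := by
  refine ⟨T.corners_of_edge_eq, fun h => ?_⟩
  rcases le_total k l with hkl | hkl
  · exact hT.edge_eq_of_ends_eq_of_le hQ hkl h
  · refine (hT.edge_eq_of_ends_eq_of_le hQ hkl ?_).symm
    rcases h with ⟨h1, h2⟩ | ⟨h1, h2⟩
    · exact Or.inl ⟨h1.symm, h2.symm⟩
    · exact Or.inr ⟨h2.symm, h1.symm⟩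

/-- The tiles form two rings, in which consecutive tiles share a point `B` of the first with the
point `D` of the second. -/
theorem exists_rings (hf : 3 ≤ f) (t₀ : Fin f) :
    ∃ (n : ℕ) (Z W : ZMod n → Fin f), Function.Injective Z ∧ Function.Injective W ∧
      (∀ i, i ∈ range Z ∨ i ∈ range W) ∧
      (∀ k, T.corner (Z k) 0 = T.corner (Z 0) 0) ∧ (∀ k, T.corner (W k) 0 = T.corner (W 0) 0) ∧
      T.corner (Z 0) 0 ≠ T.corner (W 0) 0 ∧
      (∀ k, T.corner (Z (k + 1)) 3 = T.corner (Z k) 1) ∧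
      (∀ k, T.corner (W k) 1 = T.corner (Z k) 2) ∧ (∀ k, T.corner (W k) 2 = T.corner (Z k) 1) ∧
      ∀ k, T.corner (W k) 3 = T.corner (Z (k + 1)) 2 := by
  have hU : ∀ {i j : Fin f} {k : Fin 4}, k ≠ 0 → T.corner i k = T.corner j k → i = j :=
    fun hk h => hT.eq_of_corner_eq hk h
  choose φ hφe hφA hφD using hT.exists_neighbour_zero hQ
  choose φ' hφ'e hφ'A hφ'B using hT.exists_neighbour_three hQ
  choose ψ hψe hψB hψC using hT.exists_neighbour_one hQ
  choose χ hχe hχC hχD using hT.exists_neighbour_two hQ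
  have hφφ' : ∀ i, φ (φ' i) = i := fun i => hU (k := 3) (by decide) ((hφD _).trans (hφ'B i))
  have hφ'φ : ∀ i, φ' (φ i) = i := fun i => hU (k := 1) (by decide) ((hφ'B _).trans (hφD i))
  have hψψ : ∀ i, ψ (ψ i) = i := fun i => hU (k := 1) (by decide) ((hψB _).trans (hψC i))
  -- Both tiles have their corner C at the point that is B of `i` and D of `φ i`.
  have hχφ : ∀ i, χ (φ i) = ψ i := fun i =>
    hU (k := 2) (by decide) ((hχC _).trans ((hφD i).trans (hψC i).symm))
  -- So `ψ` conjugates `φ` to its inverse: the second ring runs backwards.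
  have hφψφ : ∀ i, φ (ψ (φ i)) = ψ i := fun i => by
    rw [← hχφ i]
    exact hU (k := 3) (by decide) ((hφD _).trans ((hψB _).trans (hχD _).symm))
  set Φ : Equiv.Perm (Fin f) := ⟨φ, φ', hφ'φ, hφφ'⟩ with hΦ
  -- The first ring is the orbit of `t₀` under `φ`, indexed by `ZMod n`; the second is its image
  -- under `ψ`.
  set n := Function.minimalPeriod (Φ • ·) t₀ with hn
  set Z : ZMod n → Fin f := fun k => ((MulAction.orbitZPowersEquiv Φ t₀).symm k : Fin f) with hZ
  have hZint : ∀ m : ℤ, Z m = (Φ ^ m) t₀ := by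
    intro m
    exact congrArg Subtype.val (MulAction.orbitZPowersEquiv_symm_apply' Φ t₀ m)
  have hZinj : Function.Injective Z := fun a b h =>
    (MulAction.orbitZPowersEquiv Φ t₀).symm.injective (Subtype.ext h)
  have hZsucc : ∀ k, Z (k + 1) = φ (Z k) := by
    intro k
    obtain ⟨m, rfl⟩ := ZMod.intCast_surjective k
    have : ((m : ZMod n) + 1) = ((1 + m : ℤ) : ZMod n) := by push_cast; ring
    rw [this, hZint, hZint, zpow_add, zpow_one]
    rfl
  have hZpred : ∀ k, Z (k - 1) = φ' (Z k) := by
    intro k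
    have := hZsucc (k - 1)
    rw [sub_add_cancel] at this
    rw [this, hφ'φ]
  have hψinj : Function.Injective ψ := fun a b h => by rw [← hψψ a, h, hψψ]
  have hcover : ∀ i, i ∈ {i | i ∈ range Z ∨ i ∈ range (ψ ∘ Z)} := by
    have hpartner : ∀ i k l m, T.edge m l = T.edge i k → m ≠ i → ∀ j l', T.edge i k = T.edge j l' →
        j = i ∨ j = m := by
      intro i k l m hm hmi j l' hj
      by_cases hji : j = i
      · exact Or.inl hji
      · exact Or.inr (T.eq_of_edge_eq_of_edge_eq hj hm.symm (Ne.symm hji) hmi.symm)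
    have hstep : ∀ i j k l, T.edge i k = T.edge j l →
        j = i ∨ j = φ i ∨ j = φ' i ∨ j = ψ i ∨ j = χ i := by
      intro i j k l h
      have hne : ∀ {i j : Fin f} {k l : Fin 4}, T.corner j l = T.corner i k → k ≠ l → j ≠ i := by
        rintro i j k l h hkl rfl
        exact hkl (T.corner_injective _ h).symm
      fin_cases k
      · have := hpartner i 0 3 (φ i) (hφe i) (hne (hφD i) (by decide)) j l h
        tauto
      · have := hpartner i 1 1 (ψ i) (hψe i) (hne (hψB i) (by decide)) j l h
        tauto
      · have := hpartner i 2 2 (χ i) (hχe i) (hne (hχC i) (by decide)) j l h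
        tauto
      · have := hpartner i 3 0 (φ' i) (hφ'e i) (hne (hφ'B i) (by decide)) j l h
        tauto
    have hχψ : ∀ i, χ i = ψ (φ' i) := fun i => by rw [← hχφ, hφφ']
    have hφψ : ∀ i, φ (ψ i) = ψ (φ' i) := fun i => by
      rw [← hφψφ (φ' i), hφφ']
    have hφ'ψ : ∀ i, φ' (ψ i) = ψ (φ i) := fun i => by rw [← hφψφ, hφ'φ]
    apply T.forall_mem_of_edge_closed ⟨Z 0, Or.inl ⟨0, rfl⟩⟩
    rintro i (⟨k, rfl⟩ | ⟨k, rfl⟩) j a b h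
    · rcases hstep _ _ _ _ h with rfl | rfl | rfl | rfl | rfl
      · exact Or.inl ⟨k, rfl⟩
      · exact Or.inl ⟨k + 1, hZsucc k⟩
      · exact Or.inl ⟨k - 1, hZpred k⟩
      · exact Or.inr ⟨k, rfl⟩
      · exact Or.inr ⟨k - 1, by rw [Function.comp, hZpred, hχψ]⟩
    · simp only [Function.comp] at h
      rcases hstep _ _ _ _ h with rfl | rfl | rfl | rfl | rfl
      · exact Or.inr ⟨k, rfl⟩
      · exact Or.inr ⟨k - 1, by rw [Function.comp, hZpred, hφψ]⟩
      · exact Or.inr ⟨k + 1, by rw [Function.comp, hZsucc, hφ'ψ]⟩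
      · exact Or.inl ⟨k, (hψψ _).symm⟩
      · exact Or.inl ⟨k + 1, by rw [hZsucc, hχψ, hφ'ψ, hψψ]⟩
  have hconst : ∀ {h : Fin f → S2}, (∀ i, h (φ i) = h i) → ∀ k, h (Z k) = h (Z 0) := by
    intro h hh k
    obtain ⟨m, rfl⟩ := ZMod.intCast_surjective k
    induction m using Int.induction_on with
    | zero => simp
    | succ m ih =>
      push_cast at ih ⊢
      rw [hZsucc, hh, ih]
    | pred m ih =>
      rw [← ih, ← hh (Z ((-(m : ℤ) - 1 : ℤ) : ZMod n)), ← hZsucc]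
      push_cast
      rw [sub_add_cancel]
  have hZA : ∀ k, T.corner (Z k) 0 = T.corner (Z 0) 0 := hconst (h := (T.corner · 0)) hφA
  have hWA : ∀ k, T.corner (ψ (Z k)) 0 = T.corner (ψ (Z 0)) 0 :=
    hconst (h := fun i => T.corner (ψ i) 0) fun i => by rw [← hφA, hφψφ]
  refine ⟨n, Z, ψ ∘ Z, hZinj, hψinj.comp hZinj, hcover, hZA, hWA, ?_, ?_, ?_, ?_, ?_⟩
  · obtain ⟨i, hi⟩ := T.exists_corner_zero_ne (fun _ _ _ hk h => hU hk h) hf (Z 0)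
    rcases hcover i with ⟨k, rfl⟩ | ⟨k, rfl⟩
    · exact absurd (hZA k) hi
    · intro h
      exact hi ((hWA k).trans h.symm)
  · intro k
    rw [hZsucc, hφD]
  · exact fun k => hψB _
  · exact fun k => hψC _
  · intro k
    rw [hZsucc, Function.comp, ← hχφ, hχD]

end IsSeparated

end SphereTiling

/-! ### Identification with the earth map. -/

namespace SphereTiling

variable {Q : SphericalQuadrilateral} {f : ℕ} {T : SphereTiling Q f}

theorem IsEarthMap.mem_AVC (hT : T.IsEarthMap) : ![0, 1, 1, 1] ∈ T.AVC := by
  obtain ⟨n, hn, e, hcorner, -⟩ := hT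
  refine ⟨e.symm (0, true), 1, ?_⟩
  have hcount : ∀ m, T.vertexType (T.corner (e.symm (0, true)) 1) m =
      Nat.card {z : ZMod n × Bool // earthCorner n z m = .upper 0} := by
    intro m
    apply Nat.card_congr
    apply e.subtypeEquiv
    intro i
    rw [hcorner, Equiv.apply_symm_apply]
    rfl
  have hone : ∀ (m : Fin 4) (w : ZMod n × Bool),
      (∀ z, earthCorner n z m = .upper 0 ↔ z = w) →
      T.vertexType (T.corner (e.symm (0, true)) 1) m = 1 := by
    intro m w h
    rw [hcount, Nat.card_eq_one_iff_unique]
    exact ⟨⟨fun a b => Subtype.ext (((h _).mp a.2).trans ((h _).mp b.2).symm)⟩,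
      ⟨⟨w, (h w).mpr rfl⟩⟩⟩
  funext m
  fin_cases m
  · change 0 = T.vertexType (T.corner (e.symm (0, true)) 1) 0
    rw [hcount, eq_comm, Nat.card_eq_zero]
    left
    constructor
    rintro ⟨⟨i, b⟩, h⟩
    cases b <;> simp [earthCorner] at h
  · refine (hone 1 (0, true) ?_).symm
    rintro ⟨i, b⟩
    cases b <;> simp [earthCorner]
  · refine (hone 2 (0, false) ?_).symm
    rintro ⟨i, b⟩
    cases b <;> simp [earthCorner]
  -- The corner D of the northern tile `i` is `upper (i - 1)`, so `upper 0` is D of tile 1.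
  · refine (hone 3 (1, true) ?_).symm
    rintro ⟨i, b⟩
    cases b <;> simp [earthCorner, sub_eq_zero]

theorem IsSeparated.vertexType_of_ring (hT : T.IsSeparated) {n : ℕ} {Z W : ZMod n → Fin f}
    (hZ : Function.Injective Z) (hcover : ∀ i, i ∈ range Z ∨ i ∈ range W) {p : S2}
    (hZp : ∀ k, T.corner (Z k) 0 = p) (hWp : ∀ k, T.corner (W k) 0 ≠ p) :
    T.vertexType p = ![n, 0, 0, 0] := by
  have hzero : ∀ m, m ≠ 0 → T.vertexType p m = 0 := by
    intro m hm
    rw [vertexType, Nat.card_eq_zero]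
    left
    constructor
    rintro ⟨i, hi⟩
    rw [← hZp 0] at hi
    exact hT.corner_zero_ne _ _ hm hi.symm
  have hn : T.vertexType p 0 = n := by
    rw [← Nat.card_zmod n, vertexType]
    refine (Nat.card_congr (Equiv.ofBijective (fun k => ⟨Z k, hZp k⟩) ⟨?_, ?_⟩)).symm
    · intro a b h
      exact hZ (congrArg Subtype.val h)
    · rintro ⟨i, hi⟩
      rcases hcover i with ⟨k, rfl⟩ | ⟨k, rfl⟩
      · exact ⟨k, rfl⟩
      · exact absurd hi (hWp k)
  funext m
  fin_cases m
  · exact hn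
  · exact hzero 1 (by decide)
  · exact hzero 2 (by decide)
  · exact hzero 3 (by decide)

theorem isEarthMap_of_mem_AVC (hQ : Q.IsA2BC) (hmem : ![0, 1, 1, 1] ∈ T.AVC) :
    Even f ∧ Q.angle 0 = 4 * π / f ∧
      T.AVC = {![0, 1, 1, 1], ![f / 2, 0, 0, 0]} ∧ T.IsEarthMap := by
  have hτ := T.vertexType_eq_of_mem_AVC hQ hmem
  have hT : T.IsSeparated := isSeparated_of_vertexType hτ
  have hU : ∀ {i j : Fin f} {k : Fin 4}, k ≠ 0 → T.corner i k = T.corner j k → i = j :=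
    fun hk h => hT.eq_of_corner_eq hk h
  obtain ⟨t₀, -⟩ := id hmem
  -- Only corners A lie at a corner A, from different tiles, so the degree bound gives three tiles;
  -- `exists_rings` needs them to separate the poles.
  have hf : 3 ≤ f := by
    have hdeg : 3 ≤ ∑ l, T.vertexType (T.corner t₀ 0) l := T.degree_ge t₀ 0
    have hzero : ∀ m, m ≠ 0 → T.vertexType (T.corner t₀ 0) m = 0 := by
      intro m hm
      rw [vertexType, Nat.card_eq_zero]
      left
      exact ⟨fun x => hT.corner_zero_ne _ _ hm x.2.symm⟩
    rw [Finset.sum_eq_single 0 (fun m _ hm => hzero m hm) (by simp)] at hdeg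
    refine hdeg.trans ?_
    calc T.vertexType (T.corner t₀ 0) 0 ≤ Nat.card (Fin f) := Finite.card_subtype_le _
      _ = f := Nat.card_fin f
  obtain ⟨n, Z, W, hZ, hW, hcover, hZA, hWA, hZW, hZD, hWB, hWC, hWD⟩ :=
    hT.exists_rings hQ hf t₀
  have hNtype := hT.vertexType_of_ring hZ hcover hZA fun k h => hZW (h.symm.trans (hWA k))
  have hStype := hT.vertexType_of_ring hW (fun i => (hcover i).symm) hWA
    fun k h => hZW ((hZA k).symm.trans h)
  have hn : 3 ≤ n := by
    have hdeg : 3 ≤ ∑ l, T.vertexType (T.corner (Z 0) 0) l := T.degree_ge (Z 0) 0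
    rw [hNtype] at hdeg
    simpa [Fin.sum_univ_four] using hdeg
  set E : ZMod n × Bool → Fin f := fun z => if z.2 then Z z.1 else W z.1 with hE
  have hEbij : Function.Bijective E := by
    have hne : ∀ a b, Z a ≠ W b := fun a b h => hZW (by rw [← hZA a, ← hWA b, h])
    constructor
    · rintro ⟨a, b⟩ ⟨c, d⟩ h
      cases b <;> cases d <;> simp [hE] at h
      · rw [hW h]
      · exact absurd h.symm (hne _ _)
      · exact absurd h (hne _ _)
      · rw [hZ h]
    · intro i
      rcases hcover i with ⟨k, rfl⟩ | ⟨k, rfl⟩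
      · exact ⟨(k, true), by simp [hE]⟩
      · exact ⟨(k, false), by simp [hE]⟩
  set e := (Equiv.ofBijective E hEbij).symm with he
  have hEe : ∀ i, E (e i) = i := fun i => (Equiv.ofBijective E hEbij).apply_symm_apply i
  have hfn : f = n * 2 := by
    have := Nat.card_congr e
    rwa [Nat.card_fin, Nat.card_prod, Nat.card_zmod, Nat.card_eq_fintype_card (α := Bool),
      Fintype.card_bool] at this
  have hfhalf : f / 2 = n := by omega
  refine ⟨⟨n, by omega⟩, ?_, ?_, n, hn, e, ?_⟩
  · have hsum := T.sum_angle_eq (Z 0) 0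
    rw [hNtype, Fin.sum_univ_four] at hsum
    have hn0 : (n : ℝ) ≠ 0 := by
      have : n ≠ 0 := by omega
      exact_mod_cast this
    rw [hfn, eq_div_iff (by push_cast; positivity)]
    push_cast
    simp at hsum
    linarith
  · rw [hfhalf]
    apply Subset.antisymm
    · rintro v ⟨i, k, rfl⟩
      by_cases hk : k = 0
      · right
        rw [hk, mem_singleton_iff]
        rcases hcover i with ⟨m, rfl⟩ | ⟨m, rfl⟩
        · rw [hZA, hNtype]
        · rw [hWA, hStype]
      · left
        exact hτ i k hk
    · rintro v (rfl | rfl)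
      · exact hmem
      · exact ⟨Z 0, 0, hNtype.symm⟩
  -- The points of both rings are named by the corners B and C of the first ring; the gluing
  -- relations express the corners of `W` through them.
  set V : EarthVertex n → S2 := fun
    | .north => T.corner (Z 0) 0
    | .south => T.corner (W 0) 0
    | .upper k => T.corner (Z k) 1
    | .lower k => T.corner (Z k) 2 with hV
  have hVinj : Function.Injective V := by
    -- The corner B of `Z a` is C of `W a`, so such a coincidence would make a tile of one ring a
    -- tile of the other.
    have hne : ∀ a b, T.corner (Z a) 1 ≠ T.corner (Z b) 2 := by
      intro a b h
      have hab : W a = Z b := hU (by decide) ((hWC a).trans h)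
      exact hZW (by rw [← hZA b, ← hWA a, hab])
    rintro (_ | _ | a | a) (_ | _ | b | b) h
    · rfl
    · exact absurd h hZW
    · exact absurd h (hT.corner_zero_ne _ _ (by decide))
    · exact absurd h (hT.corner_zero_ne _ _ (by decide))
    · exact absurd h.symm hZW
    · rfl
    · exact absurd h (hT.corner_zero_ne _ _ (by decide))
    · exact absurd h (hT.corner_zero_ne _ _ (by decide))
    · exact absurd h.symm (hT.corner_zero_ne _ _ (by decide))
    · exact absurd h.symm (hT.corner_zero_ne _ _ (by decide))
    · rw [hZ (hU (by decide) h)]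
    · exact absurd h (hne a b)
    · exact absurd h.symm (hT.corner_zero_ne _ _ (by decide))
    · exact absurd h.symm (hT.corner_zero_ne _ _ (by decide))
    · exact absurd h.symm (hne b a)
    · rw [hZ (hU (by decide) h)]
  have hcorner : ∀ z k, T.corner (E z) k = V (earthCorner n z k) := by
    rintro ⟨a, b⟩ k
    cases b <;> fin_cases k
    · exact hWA a
    · exact hWB a
    · exact hWC a
    · exact hWD a
    · exact hZA a
    · rfl
    · rfl
    · have := hZD (a - 1)
      rw [sub_add_cancel] at this
      exact this
  have hcorner_iff : ∀ i j k l,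
      T.corner i k = T.corner j l ↔ earthCorner n (e i) k = earthCorner n (e j) l := by
    intro i j k l
    rw [← hVinj.eq_iff, ← hcorner, ← hcorner, hEe, hEe]
  refine ⟨hcorner_iff, fun i j k l => ?_⟩
  rw [hT.edge_eq_iff hQ, earthEdge, earthEdge, Sym2.eq_iff]
  simp only [hcorner_iff]

end SphereTiling

theorem mainTheorem2 (Q : SphericalQuadrilateral) (hQ : Q.IsA2BC) (f : ℕ)
    (T : SphereTiling Q f) :
    (![0, 1, 1, 1] ∈ T.AVC →
      Even f ∧ Q.angle 0 = 4 * π / f ∧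
        T.AVC = {![0, 1, 1, 1], ![f / 2, 0, 0, 0]} ∧ T.IsEarthMap) ∧
    (T.IsEarthMap → ![0, 1, 1, 1] ∈ T.AVC) :=
  ⟨SphereTiling.isEarthMap_of_mem_AVC hQ, SphereTiling.IsEarthMap.mem_AVC⟩
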